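/- All manifolds, maps and forms are smooth. **Conventions.** Let $(M,\eta)$ be a contact manifold of dimension $2n+1$, i.e. $\eta$ is a one-form with $\eta\wedge(d\eta)^n$ nowhere zero. Put $\flat(v)=\iota_v d\eta+\eta(v)\eta$. The Reeb field is given by $\flat(\mathcal R)=\eta$. The Hamiltonian vector field $X_f$ of $f\in C^\infty(M)$ is given by $\flat(X_f)=df-(\mathcal R(f)+f)\,\eta$. The Jacobi bracket is $\{f,g\}_\eta=-d\eta(\flat^{-1}df,\flat^{-1}dg)-f\,\mathcal R(g)+g\,\mathcal R(f)$. An exact symplectic manifold $(M^\Sigma,\theta)$ is a manifold with a one-form $\theta$ such that $\omega=-d\theta$ is nondegenerate. Its Liouville field $\Delta$ is given by $\iota_\Delta\omega=-\theta$. The Hamiltonian vector field of a function $h$ on $M^\Sigma$ is given by $\iota_{X_h}\omega=dh$. The Poisson bracket is $\{h,k\}_\theta=\omega(X_h,X_k)$. A function $h$ on $M^\Sigma$ is homogeneous of degree $1$ if $\Delta(h)=h$. A symplectization with conformal factor $\sigma$ is a (locally trivial, surjective) fibre bundle $\Sigma\colon M^\Sigma\to M$ with $\Sigma_*(\ker\theta)=\ker\eta$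 outside the zeros of $\theta$, together with a nowhere-vanishing function $\sigma\colon M^\Sigma\to\mathbb R$ such that $\sigma\,\Sigma^*\eta=\theta$. A homogeneous integrable system $(M^\Sigma,\theta,(h_1,\dots,h_m))$ is an exact symplectic manifold of dimension $2m$ with functions $h_1,\dots,h_m$ that are homogeneous of degree $1$, satisfy $\{h_i,h_j\}_\theta=0$, and whose differentials are linearly independent at every point. A completely integrable contact system $(M,\eta,F)$ is a contact manifold of dimension $2n+1$ with a map $F=(f_0,\dots,f_n)\colon M\to\mathbb R^{n+1}$ such that $\{f_\alpha,f_\beta\}_\eta=0$ for all $\alpha,\beta$ and $\operatorname{rank}T_xF\ge n$ for every $x\in M$. **Theorem.** Let $(M,\eta)$ be a (nonempty) contact manifold of dimension $2n+1$, $(M^\Sigma,\theta)$ an exact symplectic manifold, and $\Sigma\colon M^\Sigma\to M$ a symplectization with conformal factor $\sigma$. For $f\in C^\infty(M)$ put $f^\Sigma=-\sigma\,\Sigma^*f$. 1. The map $f\mapsto f^\Sigma$ is injective from $C^\infty(M)$ to the smooth functions on $M^\Sigma$ that are homogeneous of degree $1$. If the fibres of $\Sigma$ are connected, it is a bijection between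 these two sets. 2. For every $f\in C^\infty(M)$ one has $\Sigma_*X_{f^\Sigma}=X_f$, and $f^\Sigma$ is the only smooth function $h$ on $M^\Sigma$, homogeneous of degree $1$, with $\Sigma_*X_h=X_f$. 3. For all $f,g\in C^\infty(M)$, $$\{f^\Sigma,g^\Sigma\}_\theta=-\bigl(\{f,g\}_\eta\bigr)^\Sigma,\qquad\text{and}\qquad \{\sigma\,\Sigma^*f,\ \sigma\,\Sigma^*g\}_\theta=\sigma\,\Sigma^*\{f,g\}_\eta .$$ 4. Let $F=(f_0,\dots,f_n)\colon M\to\mathbb R^{n+1}$ and $F^\Sigma=-\sigma\,\Sigma^*F=(f_0^\Sigma,\dots,f_n^\Sigma)$. Then $(M^\Sigma,\theta,F^\Sigma)$ is a homogeneous integrable system if and only if $(M,\eta,F)$ is a completely integrable contact system and, for every $x\in M$, $$T_xF(T_xM)+\mathbb R\,F(x)=\mathbb R^{n+1}$$ (that is, $F/\|F\|\colon M\setminus F^{-1}(0)\to\mathbb S^n$ is a submersion, and $F$ is a submersion at every point of $F^{-1}(0)$). -/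

import Mathlib

open scoped Manifold ContDiff

noncomputable section

namespace ContactSymp

section OneForms

variable {E : Type*} [NormedAddCommGroup E] [NormedSpace ℝ E]
  {M : Type*} [TopologicalSpace M] [ChartedSpace E M]

/-- A (not necessarily smooth) one-form on a manifold `M` without boundary modelled on `E`:
a family of covectors. -/
abbrev OneForm (E : Type*) [NormedAddCommGroup E] [NormedSpace ℝ E]
    (M : Type*) [TopologicalSpace M] [ChartedSpace E M] :=
  ∀ x : M, TangentSpace 𝓘(ℝ, E) x →L[ℝ] ℝ

/-- The one-form `α` is a smooth section of the cotangent bundle. -/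
def IsSmoothOneForm [IsManifold 𝓘(ℝ, E) ∞ M] (α : OneForm E M) : Prop :=
  ContMDiff 𝓘(ℝ, E) (𝓘(ℝ, E).prod 𝓘(ℝ, E →L[ℝ] ℝ)) ∞
    (fun x : M => (Bundle.TotalSpace.mk' (E →L[ℝ] ℝ) x (α x) :
      Bundle.TotalSpace (E →L[ℝ] ℝ)
        (fun x : M => TangentSpace 𝓘(ℝ, E) x →L[ℝ] Bundle.Trivial M ℝ x)))

/-- The expression of `α` in the preferred chart `φ` at `x₀`: the pullback of `α` by `φ⁻¹`,
a covector-valued function on (the image of `φ` in) the model space. -/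
def coordExpr (α : OneForm E M) (x₀ : M) : E → E →L[ℝ] ℝ := fun y =>
  (α ((extChartAt 𝓘(ℝ, E) x₀).symm y)).comp
    (mfderiv 𝓘(ℝ, E) 𝓘(ℝ, E) (extChartAt 𝓘(ℝ, E) x₀).symm y)

/-- The exterior derivative of a one-form, `dα(v, w) = D_v(α̃(w)) - D_w(α̃(v))`, where `α̃` is the
expression of `α` in the preferred chart at the point. (The tangent space at `x` is the model
space `E`, through the derivative of the preferred chart at `x`.) -/
def extDer (α : OneForm E M) (x : M) :
    TangentSpace 𝓘(ℝ, E) x →L[ℝ] TangentSpace 𝓘(ℝ, E) x →L[ℝ] ℝ :=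
  let D : E →L[ℝ] E →L[ℝ] ℝ := fderiv ℝ (coordExpr α x) (extChartAt 𝓘(ℝ, E) x x)
  (D - D.flip : E →L[ℝ] E →L[ℝ] ℝ)

/-- The differential of a function. -/
def differential (E : Type*) [NormedAddCommGroup E] [NormedSpace ℝ E]
    {M : Type*} [TopologicalSpace M] [ChartedSpace E M] (f : M → ℝ) : OneForm E M :=
  fun x => mfderiv 𝓘(ℝ, E) 𝓘(ℝ, ℝ) f x

/-- The space of smooth functions. -/
def smoothFun (E : Type*) [NormedAddCommGroup E] [NormedSpace ℝ E]
    (M : Type*) [TopologicalSpace M] [ChartedSpace E M] : Set (M → ℝ) :=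
  {f | ContMDiff 𝓘(ℝ, E) 𝓘(ℝ, ℝ) ∞ f}

end OneForms

section Contact

variable {E : Type*} [NormedAddCommGroup E] [NormedSpace ℝ E]
  {M : Type*} [TopologicalSpace M] [ChartedSpace E M]

/-- The value of the `(2n+1)`-form `η ∧ (dη)^n` at `x` on the tangent vectors `v 0, …, v (2n)`. -/
def contactVolume (n : ℕ) (η : OneForm E M) (x : M)
    (v : Fin (2 * n + 1) → TangentSpace 𝓘(ℝ, E) x) : ℝ :=
  (1 / 2 : ℝ) ^ n * ∑ π : Equiv.Perm (Fin (2 * n + 1)), ((Equiv.Perm.sign π : ℤ) : ℝ) *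
    (η x (v (π ⟨0, by omega⟩)) *
      ∏ i : Fin n, extDer η x (v (π ⟨2 * i.1 + 1, by omega⟩)) (v (π ⟨2 * i.1 + 2, by omega⟩)))

/-- `(M, η)` is a contact manifold of dimension `2n+1`: `η` is a smooth one-form such that
`η ∧ (dη)^n` vanishes nowhere. -/
structure IsContactForm [IsManifold 𝓘(ℝ, E) ∞ M] (n : ℕ) (η : OneForm E M) : Prop where
  finrank_eq : Module.finrank ℝ E = 2 * n + 1
  smooth : IsSmoothOneForm η
  volume_ne_zero : ∀ x : M, ∃ v : Fin (2 * n + 1) → TangentSpace 𝓘(ℝ, E) x,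
    contactVolume n η x v ≠ 0

/-- The map `♭ : v ↦ ι_v dη + η(v) η`, an isomorphism `T_x M → T_x^* M` for a contact form. -/
def flat (η : OneForm E M) (x : M) :
    TangentSpace 𝓘(ℝ, E) x →L[ℝ] TangentSpace 𝓘(ℝ, E) x →L[ℝ] ℝ :=
  extDer η x + (η x).smulRight (η x)

/-- The inverse of `♭`. -/
def flatInv (η : OneForm E M) (x : M) :
    (TangentSpace 𝓘(ℝ, E) x →L[ℝ] ℝ) →L[ℝ] TangentSpace 𝓘(ℝ, E) x :=
  (flat η x).inverse

/-- The Reeb vector field, `♭(R) = η`. -/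
def reeb (η : OneForm E M) (x : M) : TangentSpace 𝓘(ℝ, E) x :=
  flatInv η x (η x)

/-- The contact Hamiltonian vector field, `♭(X_f) = df - (R(f) + f) η`. -/
def contactHam (η : OneForm E M) (f : M → ℝ) (x : M) : TangentSpace 𝓘(ℝ, E) x :=
  flatInv η x (differential E f x - (differential E f x (reeb η x) + f x) • η x)

/-- The Jacobi bracket `{f, g} = -dη(♭⁻¹ df, ♭⁻¹ dg) - f R(g) + g R(f)`. -/
def jacobiBracket (η : OneForm E M) (f g : M → ℝ) (x : M) : ℝ :=
  -extDer η x (flatInv η x (differential E f x)) (flatInv η x (differential E g x))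
    - f x * differential E g x (reeb η x) + g x * differential E f x (reeb η x)

/-- `(M, η, F)` is a completely integrable contact system, `F = (f₀, …, f_n)`. -/
structure IsCompletelyIntegrableContact [IsManifold 𝓘(ℝ, E) ∞ M] (n : ℕ) (η : OneForm E M)
    (F : M → Fin (n + 1) → ℝ) : Prop where
  contact : IsContactForm n η
  smooth : ContMDiff 𝓘(ℝ, E) 𝓘(ℝ, Fin (n + 1) → ℝ) ∞ F
  involution : ∀ (i j : Fin (n + 1)) (x : M),
    jacobiBracket η (fun y => F y i) (fun y => F y j) x = 0
  rank_ge : ∀ x : M,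
    n ≤ Module.finrank ℝ
      (LinearMap.range (mfderiv 𝓘(ℝ, E) 𝓘(ℝ, Fin (n + 1) → ℝ) F x).toLinearMap)

/-- The image of `T_x F` and the vector `F(x)` together span `ℝᵏ`, for every `x`. Where
`F(x) ≠ 0` this says that the map to the sphere `F / ‖F‖` is a submersion at `x`; where
`F(x) = 0` it says that `F` is a submersion at `x`. -/
def IsTransverseToRays {k : ℕ} (E : Type*) [NormedAddCommGroup E] [NormedSpace ℝ E]
    {M : Type*} [TopologicalSpace M] [ChartedSpace E M] (F : M → Fin k → ℝ) : Prop :=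
  ∀ x : M, (LinearMap.range (mfderiv 𝓘(ℝ, E) 𝓘(ℝ, Fin k → ℝ) F x).toLinearMap :
      Submodule ℝ (Fin k → ℝ)) ⊔ Submodule.span ℝ {F x} = ⊤

end Contact

section Symplectic

variable {E : Type*} [NormedAddCommGroup E] [NormedSpace ℝ E]
  {M : Type*} [TopologicalSpace M] [ChartedSpace E M]

/-- The two-form `ω = -dθ`. -/
def sympForm (θ : OneForm E M) (x : M) :
    TangentSpace 𝓘(ℝ, E) x →L[ℝ] TangentSpace 𝓘(ℝ, E) x →L[ℝ] ℝ :=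
  -extDer θ x

/-- `(M, θ)` is an exact symplectic manifold: `ω = -dθ` is nondegenerate. -/
structure IsExactSymplectic [IsManifold 𝓘(ℝ, E) ∞ M] (θ : OneForm E M) : Prop where
  smooth : IsSmoothOneForm θ
  nondegenerate : ∀ (x : M) (v : TangentSpace 𝓘(ℝ, E) x),
    (∀ w : TangentSpace 𝓘(ℝ, E) x, sympForm θ x v w = 0) → v = 0

/-- The Liouville vector field, `ι_Δ ω = -θ`. -/
def liouville (θ : OneForm E M) (x : M) : TangentSpace 𝓘(ℝ, E) x :=
  (sympForm θ x).inverse (-θ x)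

/-- The symplectic Hamiltonian vector field, `ι_{X_f} ω = df`. -/
def sympHam (θ : OneForm E M) (f : M → ℝ) (x : M) : TangentSpace 𝓘(ℝ, E) x :=
  (sympForm θ x).inverse (differential E f x)

/-- The Poisson bracket `{f, g} = ω(X_f, X_g)`. -/
def poissonBracket (θ : OneForm E M) (f g : M → ℝ) (x : M) : ℝ :=
  sympForm θ x (sympHam θ f x) (sympHam θ g x)

/-- The function `f` is homogeneous of degree `k`: `Δ(f) = k f`. -/
def IsHomogeneousFun (θ : OneForm E M) (k : ℤ) (f : M → ℝ) : Prop :=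
  ∀ x : M, differential E f x (liouville θ x) = k * f x

/-- The space of smooth functions that are homogeneous of degree `k`. -/
def homogeneousFun (θ : OneForm E M) (k : ℤ) : Set (M → ℝ) :=
  {f | f ∈ smoothFun E M ∧ IsHomogeneousFun θ k f}

/-- `(M, θ, F)` is a `2m`-dimensional homogeneous integrable system, `F = (f₁, …, f_m)`. -/
structure IsHomogeneousIntegrable [IsManifold 𝓘(ℝ, E) ∞ M] (m : ℕ) (θ : OneForm E M)
    (F : M → Fin m → ℝ) : Prop where
  finrank_eq : Module.finrank ℝ E = 2 * m
  symplectic : IsExactSymplectic θ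
  smooth : ContMDiff 𝓘(ℝ, E) 𝓘(ℝ, Fin m → ℝ) ∞ F
  independent : ∀ x : M, LinearIndependent ℝ (fun i : Fin m => differential E (fun y => F y i) x)
  involution : ∀ (i j : Fin m) (x : M),
    poissonBracket θ (fun y => F y i) (fun y => F y j) x = 0
  homogeneous : ∀ i : Fin m, IsHomogeneousFun θ 1 (fun y => F y i)

end Symplectic

section Symplectization

variable {E : Type*} [NormedAddCommGroup E] [NormedSpace ℝ E]
  {M : Type*} [TopologicalSpace M] [ChartedSpace E M]
  {E' : Type*} [NormedAddCommGroup E'] [NormedSpace ℝ E']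
  {N : Type*} [TopologicalSpace N] [ChartedSpace E' N]

/-- `p : N → M` is a smooth locally trivial fibre bundle with typical fibre the manifold `Q`
(modelled on `EQ`). -/
structure IsSmoothFiberBundle (E E' EQ Q : Type*)
    [NormedAddCommGroup E] [NormedSpace ℝ E] [NormedAddCommGroup E'] [NormedSpace ℝ E']
    [NormedAddCommGroup EQ] [NormedSpace ℝ EQ]
    [TopologicalSpace Q] [ChartedSpace EQ Q]
    {M N : Type*} [TopologicalSpace M] [ChartedSpace E M]
    [TopologicalSpace N] [ChartedSpace E' N] (p : N → M) : Prop where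
  smooth : ContMDiff 𝓘(ℝ, E') 𝓘(ℝ, E) ∞ p
  surjective : Function.Surjective p
  locally_trivial : ∀ x : M, ∃ e : Bundle.Trivialization Q p, x ∈ e.baseSet ∧
    ContMDiffOn 𝓘(ℝ, E') (𝓘(ℝ, E).prod 𝓘(ℝ, EQ)) ∞ e e.source ∧
    ContMDiffOn (𝓘(ℝ, E).prod 𝓘(ℝ, EQ)) 𝓘(ℝ, E') ∞ e.toOpenPartialHomeomorph.symm e.target

/-- The fibre bundle `p : (N, θ) → (M, η)` is a symplectization: `p_* (ker θ) = ker η` outside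
the singular points of `θ`. -/
structure IsSymplectization (EQ Q : Type*) [NormedAddCommGroup EQ] [NormedSpace ℝ EQ]
    [TopologicalSpace Q] [ChartedSpace EQ Q]
    (η : OneForm E M) (θ : OneForm E' N) (p : N → M) : Prop where
  bundle : IsSmoothFiberBundle E E' EQ Q p
  map_ker : ∀ y : N, θ y ≠ 0 →
    Submodule.map (mfderiv 𝓘(ℝ, E') 𝓘(ℝ, E) p y).toLinearMap
      (LinearMap.ker (θ y).toLinearMap) = LinearMap.ker (η (p y)).toLinearMap

/-- `σ` is the conformal factor of `p`: a nowhere-vanishing smooth function with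
`σ (p^* η) = θ`. -/
structure IsConformalFactor (η : OneForm E M) (θ : OneForm E' N) (p : N → M)
    (σ : N → ℝ) : Prop where
  smooth : ContMDiff 𝓘(ℝ, E') 𝓘(ℝ, ℝ) ∞ σ
  ne_zero : ∀ y : N, σ y ≠ 0
  smul_pullback : ∀ (y : N) (v : TangentSpace 𝓘(ℝ, E') y),
    σ y * η (p y) (mfderiv 𝓘(ℝ, E') 𝓘(ℝ, E) p y v) = θ y v

/-- The lift `f^Σ = -σ (p^* f)` of a function `f` on the base. -/
def symplectize {M N : Type*} (p : N → M) (σ : N → ℝ) (f : M → ℝ) : N → ℝ :=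
  fun y => -σ y * f (p y)

/-- The lift `F^Σ = -σ (p^* F)` of a map `F` to `ℝᵏ`, taken componentwise. -/
def symplectizeMap {M N : Type*} {k : ℕ} (p : N → M) (σ : N → ℝ) (F : M → Fin k → ℝ) :
    N → Fin k → ℝ :=
  fun y i => symplectize p σ (fun x => F x i) y

end Symplectization

end ContactSymp

end

open ContactSymp

/-! Write `p` for the projection. The relation `θ = σ p^*η` gives `dθ = dσ ∧ p^*η + σ p^*dη`
(`extDer_smul_pullback`). A tangent vector killed by both `dσ` and `Tp` is killed by `dθ`, so `(dσ,
Tp)` is injective into `ℝ × TM`. Since `Tp` is onto, `TM` has odd dimension and a symplectic space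
has even dimension, `(dσ, Tp)` is an isomorphism (`bijective_differential_prod`).

A tangent vector upstairs is therefore a pair (value of `dσ`, projection), and nondegeneracy of `dθ`
allows each Hamiltonian or Liouville vector to be identified by checking a candidate pair: `Δ` is
`(σ, 0)` and `X_{f^Σ}` is `(σ R(f), X_f)`. The bracket identities follow by substitution into the
formula for `dθ`. Uniqueness in the second part comes from `g = dg(Δ) = θ(X_g) = σ η(X_f) = -σ f`.

Vertical vectors are multiples of `Δ`, so for `g` homogeneous of degree one the quotient `g / (-σ)`
has zero vertical derivative; it is constant on connected fibres and descends to the base.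

For integrability, `d(∑ cᵢ fᵢ^Σ)(v) = -(dσ(v) c·F + σ c·dF(Tp v))`. As `(dσ, Tp)` is onto, this
vanishes for all `v` exactly when `c` is orthogonal to `F` and to the range of `dF`. Hence
independence upstairs is the spanning condition downstairs. -/

namespace ContactSymp

/-! ### Alternating forms, and inverting a nondegenerate bilinear form -/

section LinearAlgebra

variable {V : Type*} [AddCommGroup V] [Module ℝ V] [FiniteDimensional ℝ V]

/-- An alternating bilinear form on a space of odd dimension is degenerate. -/
theorem exists_ne_zero_of_alternating_of_odd (B : V → V → ℝ)
    (hadd : ∀ u v w, B (u + v) w = B u w + B v w) (hsmul : ∀ (r : ℝ) v w, B (r • v) w = r * B v w)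
    (hswap : ∀ v w, B v w = -B w v) (hodd : Odd (Module.finrank ℝ V)) :
    ∃ v : V, v ≠ 0 ∧ ∀ w, B v w = 0 := by
  let L : V →ₗ[ℝ] V →ₗ[ℝ] ℝ := LinearMap.mk₂ ℝ B hadd hsmul
    (fun u v w => by rw [hswap, hadd, hswap v, hswap w]; ring)
    (fun r v w => by rw [hswap, hsmul, hswap v, smul_eq_mul]; ring)
  let b := Module.finBasis ℝ V
  let A : Matrix (Fin (Module.finrank ℝ V)) (Fin (Module.finrank ℝ V)) ℝ :=
    Matrix.of fun i j => B (b i) (b j)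
  have hA : A.transpose = -A := by
    ext i j
    exact hswap _ _
  have hdet : A.det = 0 := by
    -- In odd size, antisymmetry gives `det A = det Aᵀ = -det A`.
    have h := A.det_transpose
    rw [hA, Matrix.det_neg, Fintype.card_fin, hodd.neg_one_pow] at h
    linarith
  obtain ⟨c, hc, hcA⟩ := Matrix.exists_vecMul_eq_zero_iff.2 hdet
  refine ⟨∑ i, c i • b i, fun h => hc ?_, fun w => ?_⟩
  · exact funext fun i => Fintype.linearIndependent_iff.1 b.linearIndependent c h i
  · have : L (∑ i, c i • b i) = 0 := by
      refine b.ext fun j => ?_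
      have := congrFun hcA j
      simp only [Matrix.vecMul, dotProduct, Pi.zero_apply] at this
      simpa [L, A] using this
    exact LinearMap.congr_fun this w

variable [TopologicalSpace V] [IsTopologicalAddGroup V] [ContinuousSMul ℝ V] [T2Space V]

theorem isInvertible_of_injective {B : V →L[ℝ] V →L[ℝ] ℝ} (hB : ∀ v, B v = 0 → v = 0) :
    B.IsInvertible := by
  have hinj : Function.Injective B.toLinearMap :=
    LinearMap.ker_eq_bot.1 (LinearMap.ker_eq_bot'.2 hB)
  have hdim : Module.finrank ℝ V = Module.finrank ℝ (V →L[ℝ] ℝ) := by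
    rw [← (LinearMap.toContinuousLinearMap (𝕜 := ℝ) (E := V) (F' := ℝ)).finrank_eq]
    exact (Subspace.dual_finrank_eq (K := ℝ) (V := V)).symm
  refine ⟨(LinearEquiv.ofInjectiveOfFinrankEq B.toLinearMap hinj hdim).toContinuousLinearEquiv, ?_⟩
  ext v w
  rfl

theorem apply_inverse_apply {B : V →L[ℝ] V →L[ℝ] ℝ} (hB : ∀ v, B v = 0 → v = 0)
    (α : V →L[ℝ] ℝ) : B (B.inverse α) = α :=
  DFunLike.congr_fun (isInvertible_of_injective hB).self_comp_inverse α

theorem inverse_apply_apply {B : V →L[ℝ] V →L[ℝ] ℝ} (hB : ∀ v, B v = 0 → v = 0)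
    (v : V) : B.inverse (B v) = v :=
  DFunLike.congr_fun (isInvertible_of_injective hB).inverse_comp_self v

end LinearAlgebra

/-! ### Linear algebra of the contact condition -/

section ContactLinearAlgebra

variable {V : Type*} [AddCommGroup V] [Module ℝ V]

/-- The function `(v₀, …, v₂ₙ) ↦ a(v₀) A(v₁, v₂) ⋯ A(v₂ₙ₋₁, v₂ₙ)`. -/
def contactProduct (n : ℕ) (a : V →ₗ[ℝ] ℝ) (A : V →ₗ[ℝ] V →ₗ[ℝ] ℝ)
    (v : Fin (2 * n + 1) → V) : ℝ :=
  a (v ⟨0, by omega⟩) *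
    ∏ i : Fin n, A (v ⟨2 * i.1 + 1, by omega⟩) (v ⟨2 * i.1 + 2, by omega⟩)

/-- Each slot occurs in exactly one factor: slot 0 in `a`, slots `2i+1` and `2i+2` in the `i`-th
copy of `A`. This yields additivity and homogeneity together. -/
theorem contactProduct_update [DecidableEq (Fin (2 * n + 1))] (a : V →ₗ[ℝ] ℝ)
    (A : V →ₗ[ℝ] V →ₗ[ℝ] ℝ) (v : Fin (2 * n + 1) → V) (k : Fin (2 * n + 1)) :
    ∃ l : V →ₗ[ℝ] ℝ, ∀ x, contactProduct n a A (Function.update v k x) = l x := by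
  rcases Nat.eq_zero_or_pos k.1 with hk | hk
  · refine ⟨(∏ i : Fin n, A (v ⟨2 * i.1 + 1, by omega⟩) (v ⟨2 * i.1 + 2, by omega⟩)) • a,
      fun x => ?_⟩
    obtain ⟨k, hlt⟩ := k
    obtain rfl : k = 0 := hk
    simp [contactProduct, Fin.ext_iff, mul_comm]
  · obtain ⟨i, hi⟩ : ∃ i : Fin n, k.1 = 2 * i.1 + 1 ∨ k.1 = 2 * i.1 + 2 :=
      ⟨⟨(k.1 - 1) / 2, by omega⟩, by dsimp only; omega⟩
    have hrest : ∀ x, contactProduct n a A (Function.update v k x) =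
        (a (v ⟨0, by omega⟩) * ∏ j ∈ Finset.univ.erase i,
          A (v ⟨2 * j.1 + 1, by omega⟩) (v ⟨2 * j.1 + 2, by omega⟩)) *
        A (Function.update v k x ⟨2 * i.1 + 1, by omega⟩)
          (Function.update v k x ⟨2 * i.1 + 2, by omega⟩) := by
      intro x
      rw [contactProduct, ← Finset.prod_erase_mul _ _ (Finset.mem_univ i), ← mul_assoc,
        Function.update_of_ne (by simp only [ne_eq, Fin.ext_iff]; omega)]
      congr 2
      refine Finset.prod_congr rfl fun j hj => ?_
      have hji : j.1 ≠ i.1 := fun h => (Finset.mem_erase.1 hj).1 (Fin.ext h)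
      rw [Function.update_of_ne (by simp only [ne_eq, Fin.ext_iff]; omega),
        Function.update_of_ne (by simp only [ne_eq, Fin.ext_iff]; omega)]
    rcases hi with hi | hi
    · obtain ⟨k, hlt⟩ := k
      obtain rfl : k = 2 * i.1 + 1 := hi
      refine ⟨(a (v ⟨0, by omega⟩) * ∏ j ∈ Finset.univ.erase i,
        A (v ⟨2 * j.1 + 1, by omega⟩) (v ⟨2 * j.1 + 2, by omega⟩)) •
          A.flip (v ⟨2 * i.1 + 2, by omega⟩), fun x => ?_⟩
      rw [hrest, Function.update_self,
        Function.update_of_ne (by simp only [ne_eq, Fin.ext_iff]; omega)]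
      rfl
    · obtain ⟨k, hlt⟩ := k
      obtain rfl : k = 2 * i.1 + 2 := hi
      refine ⟨(a (v ⟨0, by omega⟩) * ∏ j ∈ Finset.univ.erase i,
        A (v ⟨2 * j.1 + 1, by omega⟩) (v ⟨2 * j.1 + 2, by omega⟩)) •
          A (v ⟨2 * i.1 + 1, by omega⟩), fun x => ?_⟩
      rw [hrest, Function.update_self,
        Function.update_of_ne (by simp only [ne_eq, Fin.ext_iff]; omega)]
      rfl

/-- `contactProduct` as a multilinear map. -/
noncomputable def contactMultilinear (n : ℕ) (a : V →ₗ[ℝ] ℝ) (A : V →ₗ[ℝ] V →ₗ[ℝ] ℝ) :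
    MultilinearMap ℝ (fun _ : Fin (2 * n + 1) => V) ℝ where
  toFun := contactProduct n a A
  map_update_add' v k x y := by
    obtain ⟨l, hl⟩ := contactProduct_update a A v k
    rw [hl, hl, hl, map_add]
  map_update_smul' v k r x := by
    obtain ⟨l, hl⟩ := contactProduct_update a A v k
    rw [hl, hl, map_smul]

/-- If the alternatization of `a ⊗ A ⊗ ⋯ ⊗ A` does not vanish, then `ker a ∩ ker A = 0`. -/
theorem eq_zero_of_alternatization_contactMultilinear_ne_zero [FiniteDimensional ℝ V] {n : ℕ}
    (hV : Module.finrank ℝ V = 2 * n + 1) {a : V →ₗ[ℝ] ℝ} {A : V →ₗ[ℝ] V →ₗ[ℝ] ℝ}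
    (hne : MultilinearMap.alternatization (contactMultilinear n a A) ≠ 0)
    {u : V} (hau : a u = 0) (hAu : ∀ w, A u w = 0) (huA : ∀ w, A w u = 0) : u = 0 := by
  by_contra hu
  obtain ⟨b, k, hk⟩ : ∃ (b : Module.Basis (Fin (2 * n + 1)) ℝ V) (k : Fin (2 * n + 1)),
      b k = u := by
    have hs : LinearIndepOn ℝ id ({u} : Set V) := LinearIndepOn.singleton hu
    let b := Module.Basis.extend hs
    have hmem : u ∈ hs.extend (Set.subset_univ _) :=
      hs.subset_extend (Set.subset_univ _) (Set.mem_singleton u)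
    have : Fintype (hs.extend (Set.subset_univ _)) := FiniteDimensional.fintypeBasisIndex b
    have hcard : Fintype.card (hs.extend (Set.subset_univ _)) = 2 * n + 1 := by
      rw [← Module.finrank_eq_card_basis b, hV]
    refine ⟨b.reindex (Fintype.equivFinOfCardEq hcard),
      Fintype.equivFinOfCardEq hcard ⟨u, hmem⟩, ?_⟩
    simp [b]
  -- It suffices to evaluate on injective families of basis vectors. Such a family uses all `2n+1`
  -- of them, so `u` occurs in every term of the sum and kills the factor containing it.
  refine hne (b.ext_alternating fun v hv => ?_)
  obtain ⟨j, rfl⟩ := (Finite.injective_iff_surjective.1 hv) k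
  rw [MultilinearMap.alternatization_apply, AlternatingMap.zero_apply]
  refine Finset.sum_eq_zero fun π _ => ?_
  suffices h : contactMultilinear n a A (fun i => b (v (π i))) = 0 by
    rw [MultilinearMap.domDomCongr_apply, h, smul_zero]
  change contactProduct n a A (fun i => b (v (π i))) = 0
  obtain ⟨i, rfl⟩ := π.surjective j
  rcases Nat.eq_zero_or_pos i.1 with hi | hi
  · obtain ⟨i, hlt⟩ := i
    obtain rfl : i = 0 := hi
    rw [contactProduct, hk, hau, zero_mul]
  · obtain ⟨j, hj⟩ : ∃ j : Fin n, i.1 = 2 * j.1 + 1 ∨ i.1 = 2 * j.1 + 2 :=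
      ⟨⟨(i.1 - 1) / 2, by omega⟩, by dsimp only; omega⟩
    refine mul_eq_zero_of_right _ (Finset.prod_eq_zero (Finset.mem_univ j) ?_)
    rcases hj with hj | hj
    · obtain ⟨i, hlt⟩ := i
      obtain rfl : i = 2 * j.1 + 1 := hj
      beta_reduce
      rw [hk, hAu]
    · obtain ⟨i, hlt⟩ := i
      obtain rfl : i = 2 * j.1 + 2 := hj
      beta_reduce
      rw [hk, huA]

/-- A Reeb vector exists. -/
theorem exists_reeb_vector [FiniteDimensional ℝ V] {a : V → ℝ} {A : V → V → ℝ}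
    (hodd : Odd (Module.finrank ℝ V))
    (hasmul : ∀ (r : ℝ) v, a (r • v) = r * a v)
    (hadd : ∀ u v w, A (u + v) w = A u w + A v w) (hsmul : ∀ (r : ℝ) v w, A (r • v) w = r * A v w)
    (hswap : ∀ v w, A v w = -A w v) (hinj : ∀ v, a v = 0 → (∀ w, A v w = 0) → v = 0) :
    ∃ R, a R = 1 ∧ ∀ w, A R w = 0 := by
  obtain ⟨v, hv, hvA⟩ := exists_ne_zero_of_alternating_of_odd A hadd hsmul hswap hodd
  have hav : a v ≠ 0 := fun h => hv (hinj v h hvA)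
  exact ⟨(a v)⁻¹ • v, by rw [hasmul, inv_mul_cancel₀ hav], fun w => by rw [hsmul, hvA, mul_zero]⟩

end ContactLinearAlgebra

/-! ### The splitting of the tangent space of a symplectization -/

section SymplectizationLinearAlgebra

variable {V W : Type*} [AddCommGroup V] [Module ℝ V] [FiniteDimensional ℝ V]
  [AddCommGroup W] [Module ℝ W] [FiniteDimensional ℝ W]

/-- Let `B = s ∧ P^* a + c P^* A` be nondegenerate, where `P` maps onto a space of odd dimension.
Then `(s, P)` is bijective. -/
theorem bijective_prod_of_nondegenerate (P : V →ₗ[ℝ] W) (hP : Function.Surjective P)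
    (s : V →ₗ[ℝ] ℝ) (a : W →ₗ[ℝ] ℝ) (c : ℝ) (A : W →ₗ[ℝ] W →ₗ[ℝ] ℝ) (B : V →ₗ[ℝ] V →ₗ[ℝ] ℝ)
    (hswap : ∀ v w, B v w = -B w v)
    (hB : ∀ v w, B v w = s v * a (P w) - s w * a (P v) + c * A (P v) (P w))
    (hnd : ∀ v, (∀ w, B v w = 0) → v = 0) (hodd : Odd (Module.finrank ℝ W)) :
    Function.Bijective (s.prod P) := by
  have hinj : Function.Injective (s.prod P) := by
    refine LinearMap.ker_eq_bot.1 (LinearMap.ker_eq_bot'.2 fun v hv => hnd v fun w => ?_)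
    have h1 : s v = 0 := congrArg Prod.fst hv
    have h2 : P v = 0 := congrArg Prod.snd hv
    simp [hB, h1, h2]
  have h1 := LinearMap.finrank_le_finrank_of_injective hinj
  have h2 := LinearMap.finrank_le_finrank_of_surjective hP
  have h3 : Module.finrank ℝ (ℝ × W) = Module.finrank ℝ W + 1 := by
    rw [Module.finrank_prod, Module.finrank_self, add_comm]
  have h4 : ¬ Odd (Module.finrank ℝ V) := fun h => by
    obtain ⟨v, hv, hv0⟩ := exists_ne_zero_of_alternating_of_odd (fun v w => B v w)
      (by simp) (by simp) hswap h
    exact hv (hnd v hv0)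
  -- `dim W ≤ dim V ≤ dim W + 1`, and parity excludes the lower value.
  have h5 : Module.finrank ℝ V = Module.finrank ℝ (ℝ × W) := by
    have : Module.finrank ℝ V ≠ Module.finrank ℝ W := fun h => h4 (h ▸ hodd)
    omega
  exact ⟨hinj, (LinearMap.injective_iff_surjective_of_finrank_eq_finrank h5).1 hinj⟩

end SymplectizationLinearAlgebra

/-! ### The exterior derivative in charts and its naturality -/

section ExteriorDerivative

open Filter Topology

variable {E : Type*} [NormedAddCommGroup E] [NormedSpace ℝ E]
  {M : Type*} [TopologicalSpace M] [ChartedSpace E M]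
  {E' : Type*} [NormedAddCommGroup E'] [NormedSpace ℝ E']
  {N : Type*} [TopologicalSpace N] [ChartedSpace E' N]

theorem extDer_swap (α : OneForm E M) (x : M) (v w : TangentSpace 𝓘(ℝ, E) x) :
    extDer α x v w = -extDer α x w v := by
  change (fderiv ℝ (coordExpr α x) (extChartAt 𝓘(ℝ, E) x x) v w
    - fderiv ℝ (coordExpr α x) (extChartAt 𝓘(ℝ, E) x x) w v : ℝ) =
    -(fderiv ℝ (coordExpr α x) (extChartAt 𝓘(ℝ, E) x x) w v
    - fderiv ℝ (coordExpr α x) (extChartAt 𝓘(ℝ, E) x x) v w)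
  ring

theorem mfderiv_eq_fderiv_written {f : M → N} {x : M}
    (hf : MDifferentiableAt 𝓘(ℝ, E) 𝓘(ℝ, E') f x) :
    mfderiv 𝓘(ℝ, E) 𝓘(ℝ, E') f x =
      (fderiv ℝ (extChartAt 𝓘(ℝ, E') (f x) ∘ f ∘ (extChartAt 𝓘(ℝ, E) x).symm)
        (extChartAt 𝓘(ℝ, E) x x) : E →L[ℝ] E') := by
  refine hf.mfderiv.trans ?_
  rw [ModelWithCorners.range_eq_univ, fderivWithin_univ]
  rfl

variable [IsManifold 𝓘(ℝ, E) ∞ M] [IsManifold 𝓘(ℝ, E') ∞ N]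

/-- The inverse of the preferred chart at `x` has identity derivative at the image of `x`. -/
theorem coordExpr_self (α : OneForm E M) (x : M) :
    coordExpr α x (extChartAt 𝓘(ℝ, E) x x) = (α x : E →L[ℝ] ℝ) := by
  have : IsManifold 𝓘(ℝ, E) 1 M := IsManifold.of_le (n := ∞) (by simp)
  have h := mfderivWithin_range_extChartAt_symm (I := 𝓘(ℝ, E)) (x := x)
  rw [ModelWithCorners.range_eq_univ, mfderivWithin_univ] at h
  unfold coordExpr
  rw [h]
  have h2 := extChartAt_to_inv (I := 𝓘(ℝ, E)) x
  ext v
  change (α _ : E →L[ℝ] ℝ) v = (α x : E →L[ℝ] ℝ) v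
  rw [h2]

theorem contMDiffAt_extChartAt_symm_self (x : M) :
    ContMDiffAt 𝓘(ℝ, E) 𝓘(ℝ, E) ∞ (extChartAt 𝓘(ℝ, E) x).symm (extChartAt 𝓘(ℝ, E) x x) :=
  (contMDiffOn_extChartAt_symm x).contMDiffAt (extChartAt_target_mem_nhds x)

theorem IsSmoothOneForm.contDiffAt_coordExpr {α : OneForm E M} (hα : IsSmoothOneForm α) (x : M) :
    ContDiffAt ℝ ∞ (coordExpr α x) (extChartAt 𝓘(ℝ, E) x x) := by
  have : IsManifold 𝓘(ℝ, E) 1 M := IsManifold.of_le (n := ∞) (by simp)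
  have h := ((contMDiffAt_hom_bundle _).1 (hα x)).2
  have h3 := (ContMDiffAt.comp (extChartAt 𝓘(ℝ, E) x x)
    (by rw [extChartAt_to_inv]; exact h)
    (contMDiffAt_extChartAt_symm_self x)).contDiffAt
  refine h3.congr_of_eventuallyEq ?_
  filter_upwards [extChartAt_target_mem_nhds (I := 𝓘(ℝ, E)) x] with z hz
  simp only [Function.comp_apply]
  have hs : (extChartAt 𝓘(ℝ, E) x).symm z ∈ (chartAt E x).source := by
    simpa using (extChartAt 𝓘(ℝ, E) x).map_target hz
  rw [ContinuousLinearMap.inCoordinates]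
  rw [TangentBundle.symmL_trivializationAt hs, ModelWithCorners.range_eq_univ, mfderivWithin_univ,
    (extChartAt 𝓘(ℝ, E) x).right_inv hz]
  ext v
  simp [coordExpr]

/-- The Leibniz rule `d(σ p^*η) = dσ ∧ p^*η + σ p^*dη`. -/
theorem extDer_smul_pullback {η : OneForm E M} (hη : IsSmoothOneForm η) {p : N → M}
    (hp : ContMDiff 𝓘(ℝ, E') 𝓘(ℝ, E) ∞ p) {σ : N → ℝ} (hσ : ContMDiff 𝓘(ℝ, E') 𝓘(ℝ, ℝ) ∞ σ)
    {θ : OneForm E' N} (hθ : ∀ (y : N) (v : TangentSpace 𝓘(ℝ, E') y),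
      θ y v = σ y * η (p y) (mfderiv 𝓘(ℝ, E') 𝓘(ℝ, E) p y v))
    (y : N) (v w : TangentSpace 𝓘(ℝ, E') y) :
    extDer θ y v w =
      differential E' σ y v * η (p y) (mfderiv 𝓘(ℝ, E') 𝓘(ℝ, E) p y w)
      - differential E' σ y w * η (p y) (mfderiv 𝓘(ℝ, E') 𝓘(ℝ, E) p y v)
      + σ y * extDer η (p y) (mfderiv 𝓘(ℝ, E') 𝓘(ℝ, E) p y v)
        (mfderiv 𝓘(ℝ, E') 𝓘(ℝ, E) p y w) := by
  have hE : IsManifold 𝓘(ℝ, E) 1 M := IsManifold.of_le (n := ∞) (by simp)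
  have hE' : IsManifold 𝓘(ℝ, E') 1 N := IsManifold.of_le (n := ∞) (by simp)
  set z₀ : E' := extChartAt 𝓘(ℝ, E') y y with hz₀
  set P : E' → E := extChartAt 𝓘(ℝ, E) (p y) ∘ p ∘ (extChartAt 𝓘(ℝ, E') y).symm with hP
  set S : E' → ℝ := σ ∘ (extChartAt 𝓘(ℝ, E') y).symm with hS
  have hPz₀ : P z₀ = extChartAt 𝓘(ℝ, E) (p y) (p y) := by simp [hP, hz₀]
  have hSz₀ : S z₀ = σ y := by simp [hS, hz₀]
  have hpd : ∀ y, MDifferentiableAt 𝓘(ℝ, E') 𝓘(ℝ, E) p y := fun y =>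
    (hp y).mdifferentiableAt (by simp)
  have hP' : mfderiv 𝓘(ℝ, E') 𝓘(ℝ, E) p y = (fderiv ℝ P z₀ : E' →L[ℝ] E) :=
    mfderiv_eq_fderiv_written (hpd y)
  have hS' : differential E' σ y = (fderiv ℝ S z₀ : E' →L[ℝ] ℝ) :=
    (mfderiv_eq_fderiv_written ((hσ y).mdifferentiableAt (by simp))).trans rfl
  have hsymm := contMDiffAt_extChartAt_symm_self (E := E') y
  have hSc : ContDiffAt ℝ ∞ S z₀ :=
    (ContMDiffAt.comp z₀ (hσ _) hsymm).contDiffAt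
  have hPc : ContDiffAt ℝ ∞ P z₀ := by
    refine ContMDiffAt.contDiffAt (ContMDiffAt.comp z₀ (I' := 𝓘(ℝ, E)) ?_
      (ContMDiffAt.comp z₀ (hp _) hsymm))
    simp only [hz₀, Function.comp_apply, extChartAt_to_inv]
    exact contMDiffAt_extChartAt
  have hCc : ContDiffAt ℝ ∞ (coordExpr η (p y)) (P z₀) :=
    hPz₀ ▸ hη.contDiffAt_coordExpr (p y)
  -- Near `z₀`, the chart expression of `θ` is `S` times the pullback of that of `η` under `P`, the
  -- chart expression of `p`. This is the chain rule applied to `p ∘ φ⁻¹ = ψ⁻¹ ∘ P`.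
  have hloc : coordExpr θ y =ᶠ[𝓝 z₀]
      fun z => S z • (coordExpr η (p y) (P z)).comp (fderiv ℝ P z) := by
    have hopen : IsOpen ((extChartAt 𝓘(ℝ, E') y).target ∩
        (extChartAt 𝓘(ℝ, E') y).symm ⁻¹' (p ⁻¹' (extChartAt 𝓘(ℝ, E) (p y)).source)) :=
      (continuousOn_extChartAt_symm y).isOpen_inter_preimage (isOpen_extChartAt_target y)
        ((isOpen_extChartAt_source (p y)).preimage hp.continuous)
    filter_upwards [hopen.mem_nhds ⟨mem_extChartAt_target y, by simp [hz₀]⟩] with z hz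
    set x : N := (extChartAt 𝓘(ℝ, E') y).symm z with hx
    have hzx : (extChartAt 𝓘(ℝ, E) (p y)).symm (P z) = p x :=
      (extChartAt 𝓘(ℝ, E) (p y)).left_inv hz.2
    have hφ : MDifferentiableAt 𝓘(ℝ, E') 𝓘(ℝ, E') (extChartAt 𝓘(ℝ, E') y).symm z :=
      ((contMDiffOn_extChartAt_symm (n := ∞) y).contMDiffAt
        ((isOpen_extChartAt_target y).mem_nhds hz.1)).mdifferentiableAt (by simp)
    have hψ : MDifferentiableAt 𝓘(ℝ, E) 𝓘(ℝ, E) (extChartAt 𝓘(ℝ, E) (p y)).symm (P z) :=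
      ((contMDiffOn_extChartAt_symm (n := ∞) (p y)).contMDiffAt
        ((isOpen_extChartAt_target (p y)).mem_nhds
          ((extChartAt 𝓘(ℝ, E) (p y)).map_source hz.2))).mdifferentiableAt (by simp)
    have hPz : MDifferentiableAt 𝓘(ℝ, E') 𝓘(ℝ, E) P z := by
      refine MDifferentiableAt.comp z (I' := 𝓘(ℝ, E)) ?_ (MDifferentiableAt.comp z (hpd _) hφ)
      exact mdifferentiableAt_extChartAt (by simpa using hz.2)
    have hcomp : (mfderiv 𝓘(ℝ, E') 𝓘(ℝ, E) p x).comp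
          (mfderiv 𝓘(ℝ, E') 𝓘(ℝ, E') (extChartAt 𝓘(ℝ, E') y).symm z) =
        ((mfderiv 𝓘(ℝ, E) 𝓘(ℝ, E) (extChartAt 𝓘(ℝ, E) (p y)).symm (P z)).comp
          (mfderiv 𝓘(ℝ, E') 𝓘(ℝ, E) P z) : E' →L[ℝ] E) := by
      have h1 := mfderiv_comp z (hpd x) hφ
      have h2 := mfderiv_comp z hψ hPz
      have h3 : p ∘ (extChartAt 𝓘(ℝ, E') y).symm =ᶠ[𝓝 z]
          (extChartAt 𝓘(ℝ, E) (p y)).symm ∘ P := by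
        filter_upwards [hopen.mem_nhds hz] with z' hz'
        exact ((extChartAt 𝓘(ℝ, E) (p y)).left_inv hz'.2).symm
      exact h1.symm.trans ((h3.mfderiv_eq (I := 𝓘(ℝ, E')) (I' := 𝓘(ℝ, E))).trans h2)
    rw [mfderiv_eq_fderiv] at hcomp
    ext v
    have hηx : (η ((extChartAt 𝓘(ℝ, E) (p y)).symm (P z)) : E →L[ℝ] ℝ) = η (p x) := by
      rw [hzx]
    refine (hθ x _).trans ?_
    change _ = σ x * (η ((extChartAt 𝓘(ℝ, E) (p y)).symm (P z)) : E →L[ℝ] ℝ) _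
    rw [hηx]
    exact congrArg (fun u : E => σ x * (η (p x) : E →L[ℝ] ℝ) u) (DFunLike.congr_fun hcomp v)
  have h1 := (hSc.differentiableAt (by simp)).hasFDerivAt
  have h2 := (hCc.differentiableAt (by simp)).hasFDerivAt
  have h3 := (hPc.differentiableAt (by simp)).hasFDerivAt
  have h4 := ((hPc.fderiv_right (m := 1) (by norm_cast)).differentiableAt (by simp)).hasFDerivAt
  have hD := (h1.smul ((h2.comp z₀ h3).clm_comp h4)).congr_of_eventuallyEq hloc
  -- Differentiating the pullback produces a term in the second derivative of `P`; its symmetry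
  -- removes that term on antisymmetrizing.
  have hsym : IsSymmSndFDerivAt ℝ P z₀ := hPc.isSymmSndFDerivAt (by
    rw [minSmoothness_of_isRCLikeNormedField]
    exact WithTop.coe_le_coe.2 le_top)
  have hC₀ : coordExpr η (p y) (P z₀) = (η (p y) : E →L[ℝ] ℝ) := by
    rw [hPz₀, coordExpr_self]
  rw [hP', hS']
  suffices key : ∀ v w : E', fderiv ℝ (coordExpr θ y) z₀ v w - fderiv ℝ (coordExpr θ y) z₀ w v =
      fderiv ℝ S z₀ v * coordExpr η (p y) (P z₀) (fderiv ℝ P z₀ w)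
      - fderiv ℝ S z₀ w * coordExpr η (p y) (P z₀) (fderiv ℝ P z₀ v)
      + S z₀ * (fderiv ℝ (coordExpr η (p y)) (P z₀) (fderiv ℝ P z₀ v) (fderiv ℝ P z₀ w)
        - fderiv ℝ (coordExpr η (p y)) (P z₀) (fderiv ℝ P z₀ w) (fderiv ℝ P z₀ v)) by
    have h := key v w
    rw [hC₀, hSz₀, hPz₀] at h
    exact h
  intro v w
  rw [hD.fderiv]
  have hvw : fderiv ℝ (fderiv ℝ P) z₀ v w = fderiv ℝ (fderiv ℝ P) z₀ w v := hsym v w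
  change (S z₀ • (coordExpr η (p y) (P z₀) (fderiv ℝ (fderiv ℝ P) z₀ v w)
        + fderiv ℝ (coordExpr η (p y)) (P z₀) (fderiv ℝ P z₀ v) (fderiv ℝ P z₀ w))
      + fderiv ℝ S z₀ v • coordExpr η (p y) (P z₀) (fderiv ℝ P z₀ w)) -
    (S z₀ • (coordExpr η (p y) (P z₀) (fderiv ℝ (fderiv ℝ P) z₀ w v)
        + fderiv ℝ (coordExpr η (p y)) (P z₀) (fderiv ℝ P z₀ w) (fderiv ℝ P z₀ v))
      + fderiv ℝ S z₀ w • coordExpr η (p y) (P z₀) (fderiv ℝ P z₀ v)) = _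
  rw [hvw]
  simp only [smul_eq_mul]
  ring

end ExteriorDerivative

/-! ### Differentials of functions -/

section Calculus

open Filter Topology

variable {E : Type*} [NormedAddCommGroup E] [NormedSpace ℝ E]
  {M : Type*} [TopologicalSpace M] [ChartedSpace E M]
  {E' : Type*} [NormedAddCommGroup E'] [NormedSpace ℝ E']
  {N : Type*} [TopologicalSpace N] [ChartedSpace E' N]

instance instFiniteDimensionalTangentSpace [FiniteDimensional ℝ E] (x : M) :
    FiniteDimensional ℝ (TangentSpace 𝓘(ℝ, E) x) :=
  inferInstanceAs (FiniteDimensional ℝ E)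

instance instT2SpaceTangentSpace (x : M) : T2Space (TangentSpace 𝓘(ℝ, E) x) :=
  inferInstanceAs (T2Space E)

theorem differential_mul {f g : M → ℝ} {x : M} (hf : MDifferentiableAt 𝓘(ℝ, E) 𝓘(ℝ, ℝ) f x)
    (hg : MDifferentiableAt 𝓘(ℝ, E) 𝓘(ℝ, ℝ) g x) (v : TangentSpace 𝓘(ℝ, E) x) :
    differential E (fun y => f y * g y) x v =
      differential E f x v * g x + f x * differential E g x v := by
  have h := (hf.hasMFDerivAt.mul hg.hasMFDerivAt).mfderiv
  refine (DFunLike.congr_fun h v).trans ?_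
  change f x * differential E g x v + g x * differential E f x v = _
  ring

theorem differential_neg (f : M → ℝ) (x : M) :
    differential E (fun y => -f y) x = -differential E f x :=
  mfderiv_neg (f := f) (x := x)

theorem differential_comp {f : M → ℝ} {p : N → M} {y : N}
    (hf : MDifferentiableAt 𝓘(ℝ, E) 𝓘(ℝ, ℝ) f (p y))
    (hp : MDifferentiableAt 𝓘(ℝ, E') 𝓘(ℝ, E) p y) (v : TangentSpace 𝓘(ℝ, E') y) :
    differential E' (fun y => f (p y)) y v =
      differential E f (p y) (mfderiv 𝓘(ℝ, E') 𝓘(ℝ, E) p y v) :=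
  DFunLike.congr_fun (mfderiv_comp y hf hp) v

theorem differential_apply_coord {ι : Type*} [Fintype ι] {F : M → ι → ℝ} {x : M}
    (hF : MDifferentiableAt 𝓘(ℝ, E) 𝓘(ℝ, ι → ℝ) F x) (i : ι) (v : TangentSpace 𝓘(ℝ, E) x) :
    differential E (fun y => F y i) x v =
      (show ι → ℝ from mfderiv 𝓘(ℝ, E) 𝓘(ℝ, ι → ℝ) F x v) i := by
  have h := mfderiv_comp (I'' := 𝓘(ℝ, ℝ)) x
    (ContinuousLinearMap.mdifferentiableAt (ContinuousLinearMap.proj (R := ℝ)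
      (φ := fun _ : ι => ℝ) i)) hF
  rw [ContinuousLinearMap.mfderiv_eq] at h
  exact DFunLike.congr_fun h v

theorem isLocallyConstant_of_mfderiv_eq_zero [IsManifold 𝓘(ℝ, E) ∞ M] {u : M → ℝ}
    (hu : MDifferentiable 𝓘(ℝ, E) 𝓘(ℝ, ℝ) u)
    (hu' : ∀ x, mfderiv 𝓘(ℝ, E) 𝓘(ℝ, ℝ) u x = 0) : IsLocallyConstant u := by
  refine (IsLocallyConstant.iff_eventually_eq u).2 fun x => ?_
  obtain ⟨r, hr, hball⟩ := Metric.mem_nhds_iff.1 (extChartAt_target_mem_nhds (I := 𝓘(ℝ, E)) x)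
  have hφ : ∀ z ∈ Metric.ball (extChartAt 𝓘(ℝ, E) x x) r,
      MDifferentiableAt 𝓘(ℝ, E) 𝓘(ℝ, E) (extChartAt 𝓘(ℝ, E) x).symm z := fun z hz =>
    ((contMDiffOn_extChartAt_symm (n := ∞) x).contMDiffAt
      ((isOpen_extChartAt_target x).mem_nhds (hball hz))).mdifferentiableAt (by simp)
  have hconst : ∀ z ∈ Metric.ball (extChartAt 𝓘(ℝ, E) x x) r,
      u ((extChartAt 𝓘(ℝ, E) x).symm z) = u x := by
    intro z hz
    have h := Metric.isOpen_ball.is_const_of_fderiv_eq_zero (𝕜 := ℝ)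
      (f := u ∘ (extChartAt 𝓘(ℝ, E) x).symm) (convex_ball _ r).isPreconnected
      (fun z hz =>
        (MDifferentiableAt.comp z (hu _) (hφ z hz)).differentiableAt.differentiableWithinAt)
      (fun z hz => ?_) hz (Metric.mem_ball_self hr)
    · simpa using h
    · rw [← mfderiv_eq_fderiv]
      refine (mfderiv_comp z (hu _) (hφ z hz)).trans ?_
      rw [hu']
      exact ContinuousLinearMap.zero_comp _
  filter_upwards [(isOpen_extChartAt_source (I := 𝓘(ℝ, E)) x).mem_nhds (mem_extChartAt_source x),
    (continuousAt_extChartAt (I := 𝓘(ℝ, E)) x).preimage_mem_nhds (Metric.ball_mem_nhds _ hr)]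
    with x' hx' hb
  rw [← hconst _ hb, (extChartAt 𝓘(ℝ, E) x).left_inv hx']

end Calculus

/-! ### Local sections of smooth fibre bundles, and descent of functions -/

section Bundle

open Filter Topology

variable {E : Type*} [NormedAddCommGroup E] [NormedSpace ℝ E]
  {M : Type*} [TopologicalSpace M] [ChartedSpace E M]
  {E' : Type*} [NormedAddCommGroup E'] [NormedSpace ℝ E']
  {N : Type*} [TopologicalSpace N] [ChartedSpace E' N]
  {EQ : Type*} [NormedAddCommGroup EQ] [NormedSpace ℝ EQ]
  {Q : Type*} [TopologicalSpace Q] [ChartedSpace EQ Q] {p : N → M}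

namespace IsSmoothFiberBundle

/-- In a local trivialization, keep the fibre coordinate of `y` fixed. -/
theorem exists_local_section (hp : IsSmoothFiberBundle E E' EQ Q p) (y : N) :
    ∃ s : M → N, s (p y) = y ∧ ContMDiffAt 𝓘(ℝ, E) 𝓘(ℝ, E') ∞ s (p y) ∧
      ∀ᶠ x in 𝓝 (p y), p (s x) = x := by
  obtain ⟨e, he, -, hsymm⟩ := hp.locally_trivial (p y)
  have hmem : ∀ {x : M} (q : Q), x ∈ e.baseSet → (x, q) ∈ e.target := fun q hx =>
    e.mem_target.2 hx
  have hy : y ∈ e.source := e.mem_source.2 he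
  refine ⟨fun x => e.toOpenPartialHomeomorph.symm (x, (e y).2), ?_, ?_, ?_⟩
  · have : (p y, (e y).2) = e y := Prod.ext (e.coe_fst hy).symm rfl
    beta_reduce
    rw [this]
    exact e.toOpenPartialHomeomorph.left_inv hy
  · exact ContMDiffAt.comp (p y) (hsymm.contMDiffAt (e.open_target.mem_nhds (hmem _ he)))
      (contMDiffAt_id.prodMk contMDiffAt_const)
  · filter_upwards [e.open_baseSet.mem_nhds he] with x hx
    exact e.proj_symm_apply (hmem _ hx)

theorem mfderiv_surjective (hp : IsSmoothFiberBundle E E' EQ Q p) (y : N) :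
    Function.Surjective (mfderiv 𝓘(ℝ, E') 𝓘(ℝ, E) p y) := by
  obtain ⟨s, hsy, hs, hps⟩ := hp.exists_local_section y
  have h := mfderiv_comp (I'' := 𝓘(ℝ, E)) (p y) ((hp.smooth (s (p y))).mdifferentiableAt (by simp))
    (hs.mdifferentiableAt (by simp))
  have h2 : mfderiv 𝓘(ℝ, E) 𝓘(ℝ, E) (p ∘ s) (p y) = mfderiv 𝓘(ℝ, E) 𝓘(ℝ, E) id (p y) :=
    Filter.EventuallyEq.mfderiv_eq hps
  have h3 : Function.Surjective (mfderiv 𝓘(ℝ, E') 𝓘(ℝ, E) p (s (p y))) := fun w =>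
    ⟨mfderiv 𝓘(ℝ, E) 𝓘(ℝ, E') s (p y) w,
      DFunLike.congr_fun (h.symm.trans (h2.trans mfderiv_id)) w⟩
  rwa [hsy] at h3

/-- Locally `f = (f ∘ p) ∘ s` for a smooth section `s`. -/
theorem contMDiff_of_comp (hp : IsSmoothFiberBundle E E' EQ Q p) {f : M → ℝ}
    (hf : ContMDiff 𝓘(ℝ, E') 𝓘(ℝ, ℝ) ∞ (fun y => f (p y))) : ContMDiff 𝓘(ℝ, E) 𝓘(ℝ, ℝ) ∞ f := by
  intro x
  obtain ⟨y, rfl⟩ := hp.surjective x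
  obtain ⟨s, hsy, hs, hps⟩ := hp.exists_local_section y
  refine (ContMDiffAt.comp (p y) (hf _) hs).congr_of_eventuallyEq ?_
  filter_upwards [hps] with x hx
  simp only [Function.comp_apply, hx]

/-- A function whose differential vanishes on vertical vectors is constant on connected fibres. -/
theorem eq_of_differential_vertical_eq_zero [IsManifold 𝓘(ℝ, EQ) ∞ Q]
    (hp : IsSmoothFiberBundle E E' EQ Q p) {h : N → ℝ} (hh : ContMDiff 𝓘(ℝ, E') 𝓘(ℝ, ℝ) ∞ h)
    (hvert : ∀ (y : N) (v : TangentSpace 𝓘(ℝ, E') y),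
      mfderiv 𝓘(ℝ, E') 𝓘(ℝ, E) p y v = 0 → differential E' h y v = 0)
    {x : M} (hx : IsPreconnected (p ⁻¹' {x})) {y y' : N} (hy : p y = x) (hy' : p y' = x) :
    h y = h y' := by
  obtain ⟨e, he, -, hsymm⟩ := hp.locally_trivial x
  have hmem : ∀ q : Q, (x, q) ∈ e.target := fun q => e.mem_target.2 he
  set j : Q → N := fun q => e.toOpenPartialHomeomorph.symm (x, q) with hj
  have hjs : ContMDiff 𝓘(ℝ, EQ) 𝓘(ℝ, E') ∞ j := fun q =>
    ContMDiffAt.comp q (hsymm.contMDiffAt (e.open_target.mem_nhds (hmem q)))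
      (contMDiffAt_const.prodMk contMDiffAt_id)
  have hpj : ∀ q, p (j q) = x := fun q => e.proj_symm_apply (hmem q)
  have hjd : ∀ q, MDifferentiableAt 𝓘(ℝ, EQ) 𝓘(ℝ, E') j q := fun q =>
    (hjs q).mdifferentiableAt (by simp)
  -- The inclusion `j` of the fibre has vertical derivative because `p ∘ j` is constant, so `h ∘ j`
  -- has zero differential on `Q`.
  have hlc : IsLocallyConstant (h ∘ j) := by
    refine isLocallyConstant_of_mfderiv_eq_zero (E := EQ)
      (fun q => MDifferentiableAt.comp q ((hh _).mdifferentiableAt (by simp)) (hjd q)) fun q => ?_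
    have h1 := mfderiv_comp q ((hh (j q)).mdifferentiableAt (by simp)) (hjd q)
    have h2 := mfderiv_comp q ((hp.smooth (j q)).mdifferentiableAt (by simp)) (hjd q)
    have h3 : p ∘ j = fun _ => x := funext hpj
    rw [h3, mfderiv_const] at h2
    refine h1.trans (ContinuousLinearMap.ext fun w => ?_)
    exact hvert _ _ (DFunLike.congr_fun h2 w).symm
  have hsource : ∀ {z : N}, p z = x → z ∈ e.source := fun hz => e.mem_source.2 (hz ▸ he)
  have hjy : ∀ {z : N}, p z = x → j (e z).2 = z := fun {z} hz => by
    have : (x, (e z).2) = e z := Prod.ext (hz.symm.trans (e.coe_fst (hsource hz)).symm) rfl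
    rw [hj]
    beta_reduce
    rw [this]
    exact e.toOpenPartialHomeomorph.left_inv (hsource hz)
  have hpre : IsPreconnected ((fun z => (e z).2) '' (p ⁻¹' {x})) :=
    hx.image _ (continuous_snd.comp_continuousOn
      (e.toOpenPartialHomeomorph.continuousOn.mono fun z (hz : p z = x) => hsource hz))
  have := hlc.apply_eq_of_isPreconnected hpre (Set.mem_image_of_mem _ hy)
    (Set.mem_image_of_mem _ hy')
  simpa only [Function.comp_apply, hjy hy, hjy hy'] using this

end IsSmoothFiberBundle

end Bundle

/-! ### Reeb and Hamiltonian vectors of a contact form -/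

section ContactPointwise

variable {E : Type*} [NormedAddCommGroup E] [NormedSpace ℝ E] [FiniteDimensional ℝ E]
  {M : Type*} [TopologicalSpace M] [ChartedSpace E M] [IsManifold 𝓘(ℝ, E) ∞ M]
  {n : ℕ} {η : OneForm E M}

omit [FiniteDimensional ℝ E] [IsManifold 𝓘(ℝ, E) ∞ M] in
theorem flat_apply (η : OneForm E M) (x : M) (v w : TangentSpace 𝓘(ℝ, E) x) :
    flat η x v w = extDer η x v w + η x v * η x w := rfl

omit [FiniteDimensional ℝ E] [IsManifold 𝓘(ℝ, E) ∞ M] in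
theorem extDer_self (η : OneForm E M) (x : M) (v : TangentSpace 𝓘(ℝ, E) x) :
    extDer η x v v = 0 := by
  linarith [extDer_swap η x v v]

namespace IsContactForm

omit [FiniteDimensional ℝ E] in
theorem finrank_tangentSpace (hη : IsContactForm n η) (x : M) :
    Module.finrank ℝ (TangentSpace 𝓘(ℝ, E) x) = 2 * n + 1 := hη.finrank_eq

/-- `ker η ∩ ker dη = 0`. -/
theorem eq_zero_of_mem_ker (hη : IsContactForm n η) {x : M} {v : TangentSpace 𝓘(ℝ, E) x}
    (hv : η x v = 0) (hv' : ∀ w, extDer η x v w = 0) : v = 0 := by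
  let A : TangentSpace 𝓘(ℝ, E) x →ₗ[ℝ] TangentSpace 𝓘(ℝ, E) x →ₗ[ℝ] ℝ :=
    ContinuousLinearMap.coeLM ℝ ∘ₗ (extDer η x).toLinearMap
  obtain ⟨u, hu⟩ := hη.volume_ne_zero x
  refine eq_zero_of_alternatization_contactMultilinear_ne_zero (hη.finrank_tangentSpace x)
    (a := (η x).toLinearMap) (A := A) (fun h => hu ?_) hv hv'
    (fun w => (extDer_swap η x w v).trans (by rw [hv', neg_zero]))
  have h0 := DFunLike.congr_fun h u
  rw [MultilinearMap.alternatization_apply, AlternatingMap.zero_apply] at h0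
  rw [contactVolume]
  -- Up to the factor `(1/2)^n`, the contact volume is the alternatization evaluated at `u`.
  refine mul_eq_zero_of_right _ (Eq.trans (Finset.sum_congr rfl fun π _ => ?_) h0)
  rw [Units.smul_def, zsmul_eq_mul]
  rfl

theorem flat_eq_zero (hη : IsContactForm n η) {x : M} (v : TangentSpace 𝓘(ℝ, E) x)
    (hv : flat η x v = 0) : v = 0 := by
  have h : ∀ w, extDer η x v w + η x v * η x w = 0 := fun w => DFunLike.congr_fun hv w
  -- Evaluating `♭(v)` at `v` itself leaves `η(v)² = 0`.
  have h1 : η x v = 0 := by simpa [extDer_self] using h v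
  exact hη.eq_zero_of_mem_ker h1 fun w => by simpa [h1] using h w

theorem reeb_spec (hη : IsContactForm n η) (x : M) :
    η x (reeb η x) = 1 ∧ ∀ w, extDer η x (reeb η x) w = 0 := by
  obtain ⟨R, hR, hR'⟩ := exists_reeb_vector (V := TangentSpace 𝓘(ℝ, E) x) (a := η x)
    (A := fun v w => extDer η x v w) ⟨n, hη.finrank_tangentSpace x⟩ (by simp) (by simp) (by simp)
    (extDer_swap η x) (fun v => hη.eq_zero_of_mem_ker)
  have h : reeb η x = R := by
    have hflat : flat η x R = η x := by
      ext w
      rw [flat_apply, hR', hR, zero_add, one_mul]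
    exact (congrArg (flat η x).inverse hflat.symm).trans (inverse_apply_apply hη.flat_eq_zero R)
  exact h ▸ ⟨hR, hR'⟩

theorem flat_flatInv (hη : IsContactForm n η) (x : M) (α : TangentSpace 𝓘(ℝ, E) x →L[ℝ] ℝ) :
    flat η x (flatInv η x α) = α :=
  apply_inverse_apply hη.flat_eq_zero α

omit [FiniteDimensional ℝ E] [IsManifold 𝓘(ℝ, E) ∞ M] in
theorem contactHam_eq_sub (η : OneForm E M) (f : M → ℝ) (x : M) : contactHam η f x =
    flatInv η x (differential E f x) - (differential E f x (reeb η x) + f x) • reeb η x := by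
  rw [contactHam, map_sub, map_smul]
  rfl

/-- Pairing `♭(X_f)` with the Reeb vector gives `η(X_f) = R(f) - (R(f) + f)`. -/
theorem form_contactHam (hη : IsContactForm n η) (f : M → ℝ) (x : M) :
    η x (contactHam η f x) = -f x := by
  have h : flat η x (contactHam η f x) (reeb η x) = _ :=
    DFunLike.congr_fun (hη.flat_flatInv x _) (reeb η x)
  rw [flat_apply, extDer_swap, (hη.reeb_spec x).2, (hη.reeb_spec x).1] at h
  simp only [sub_apply, smul_apply, smul_eq_mul,
    (hη.reeb_spec x).1] at h
  linarith

theorem extDer_contactHam (hη : IsContactForm n η) (f : M → ℝ) (x : M)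
    (w : TangentSpace 𝓘(ℝ, E) x) :
    extDer η x (contactHam η f x) w =
      differential E f x w - differential E f x (reeb η x) * η x w := by
  have h : flat η x (contactHam η f x) w = _ :=
    DFunLike.congr_fun (hη.flat_flatInv x _) w
  rw [flat_apply, hη.form_contactHam] at h
  simp only [sub_apply, smul_apply, smul_eq_mul] at h
  linarith

/-- `♭⁻¹ df` and `X_f` differ by a multiple of the Reeb vector, which `dη` annihilates. -/
theorem jacobiBracket_eq (hη : IsContactForm n η) (f g : M → ℝ) (x : M) :
    jacobiBracket η f g x = -extDer η x (contactHam η f x) (contactHam η g x)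
      - f x * differential E g x (reeb η x) + g x * differential E f x (reeb η x) := by
  have h : ∀ v, extDer η x v (reeb η x) = 0 := fun v => by
    rw [extDer_swap, (hη.reeb_spec x).2, neg_zero]
  rw [jacobiBracket, contactHam_eq_sub, contactHam_eq_sub]
  simp [h, (hη.reeb_spec x).2]

end IsContactForm

end ContactPointwise

/-! ### Defining equations of the symplectic Hamiltonian and Liouville vectors -/

section SymplecticPointwise

variable {E : Type*} [NormedAddCommGroup E] [NormedSpace ℝ E] [FiniteDimensional ℝ E]
  {M : Type*} [TopologicalSpace M] [ChartedSpace E M] [IsManifold 𝓘(ℝ, E) ∞ M]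
  {θ : OneForm E M}

namespace IsExactSymplectic

omit [FiniteDimensional ℝ E] in
theorem sympForm_eq_zero (hθ : IsExactSymplectic θ) {x : M} (v : TangentSpace 𝓘(ℝ, E) x)
    (hv : sympForm θ x v = 0) : v = 0 :=
  hθ.nondegenerate x v fun w => DFunLike.congr_fun hv w

omit [FiniteDimensional ℝ E] in
theorem eq_zero_of_extDer (hθ : IsExactSymplectic θ) {x : M} {v : TangentSpace 𝓘(ℝ, E) x}
    (hv : ∀ w, extDer θ x v w = 0) : v = 0 :=
  hθ.nondegenerate x v fun w => neg_eq_zero.2 (hv w)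

theorem extDer_sympHam (hθ : IsExactSymplectic θ) (f : M → ℝ) (x : M)
    (w : TangentSpace 𝓘(ℝ, E) x) :
    extDer θ x (sympHam θ f x) w = -differential E f x w := by
  have h : sympForm θ x (sympHam θ f x) w = _ :=
    DFunLike.congr_fun (apply_inverse_apply hθ.sympForm_eq_zero (differential E f x)) w
  exact neg_eq_iff_eq_neg.1 h

theorem extDer_liouville (hθ : IsExactSymplectic θ) (x : M) (w : TangentSpace 𝓘(ℝ, E) x) :
    extDer θ x (liouville θ x) w = θ x w := by
  have h : sympForm θ x (liouville θ x) w = _ :=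
    DFunLike.congr_fun (apply_inverse_apply hθ.sympForm_eq_zero (-θ x)) w
  exact neg_inj.1 h

end IsExactSymplectic

omit [FiniteDimensional ℝ E] [IsManifold 𝓘(ℝ, E) ∞ M] in
theorem poissonBracket_eq_neg_extDer (θ : OneForm E M) (f g : M → ℝ) (x : M) :
    poissonBracket θ f g x = -extDer θ x (sympHam θ f x) (sympHam θ g x) := rfl

end SymplecticPointwise

/-! ### Spanning tested by orthogonal vectors -/

section Transversality

/-- A proper subspace lies in the kernel of a nonzero functional, and every functional on `ι → ℝ` is
a dot product. -/
theorem eq_top_iff_forall_dotProduct_eq_zero {ι : Type*} [Fintype ι] (S : Submodule ℝ (ι → ℝ)) :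
    S = ⊤ ↔ ∀ c : ι → ℝ, (∀ s ∈ S, c ⬝ᵥ s = 0) → c = 0 := by
  classical
  refine ⟨fun h c hc => ?_, fun h => ?_⟩
  · exact dotProduct_eq_zero c fun s => hc s (h ▸ Submodule.mem_top)
  · by_contra hS
    obtain ⟨f, hf, hSf⟩ := S.exists_le_ker_of_lt_top (lt_top_iff_ne_top.2 hS)
    refine hf ?_
    have hfc : ∀ s, (fun i => f (Pi.single i 1)) ⬝ᵥ s = f s := fun s => by
      conv_rhs => rw [LinearMap.pi_apply_eq_sum_univ f s]
      exact Finset.sum_congr rfl fun i _ => by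
        have hi : (Pi.single i 1 : ι → ℝ) = fun j => if i = j then 1 else 0 :=
          funext fun j => by simp [Pi.single_apply, eq_comm]
        rw [smul_eq_mul, mul_comm, ← hi]
    have h0 := h _ fun s hs => (hfc s).trans (hSf hs)
    exact LinearMap.ext fun s => by rw [← hfc, h0, zero_dotProduct, LinearMap.zero_apply]

end Transversality

/-! ### Lifting functions, Hamiltonian fields, brackets and integrable systems -/

section Symplectization

variable {E : Type*} [NormedAddCommGroup E] [NormedSpace ℝ E] [FiniteDimensional ℝ E]
  {M : Type*} [TopologicalSpace M] [ChartedSpace E M] [IsManifold 𝓘(ℝ, E) ∞ M]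
  {E' : Type*} [NormedAddCommGroup E'] [NormedSpace ℝ E'] [FiniteDimensional ℝ E']
  {N : Type*} [TopologicalSpace N] [ChartedSpace E' N] [IsManifold 𝓘(ℝ, E') ∞ N]
  {EQ : Type*} [NormedAddCommGroup EQ] [NormedSpace ℝ EQ]
  {Q : Type*} [TopologicalSpace Q] [ChartedSpace EQ Q]

/-- A fibre bundle from an exact symplectic to a contact manifold with `θ = σ p^*η`. -/
structure IsConformalSymplectization (EQ Q : Type*) [NormedAddCommGroup EQ] [NormedSpace ℝ EQ]
    [TopologicalSpace Q] [ChartedSpace EQ Q] (n : ℕ) (η : OneForm E M) (θ : OneForm E' N)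
    (p : N → M) (σ : N → ℝ) : Prop where
  contact : IsContactForm n η
  symplectic : IsExactSymplectic θ
  bundle : IsSmoothFiberBundle E E' EQ Q p
  factor : IsConformalFactor η θ p σ

namespace IsConformalSymplectization

variable {n : ℕ} {η : OneForm E M} {θ : OneForm E' N} {p : N → M} {σ : N → ℝ}

omit [FiniteDimensional ℝ E] [FiniteDimensional ℝ E'] in
theorem mdifferentiableAt_proj (H : IsConformalSymplectization EQ Q n η θ p σ) (y : N) :
    MDifferentiableAt 𝓘(ℝ, E') 𝓘(ℝ, E) p y :=
  (H.bundle.smooth y).mdifferentiableAt (by simp)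

omit [FiniteDimensional ℝ E] [FiniteDimensional ℝ E'] in
theorem mdifferentiableAt_factor (H : IsConformalSymplectization EQ Q n η θ p σ) (y : N) :
    MDifferentiableAt 𝓘(ℝ, E') 𝓘(ℝ, ℝ) σ y :=
  (H.factor.smooth y).mdifferentiableAt (by simp)

omit [FiniteDimensional ℝ E] [FiniteDimensional ℝ E'] in
theorem extDer_eq (H : IsConformalSymplectization EQ Q n η θ p σ) (y : N)
    (v w : TangentSpace 𝓘(ℝ, E') y) :
    extDer θ y v w =
      differential E' σ y v * η (p y) (mfderiv 𝓘(ℝ, E') 𝓘(ℝ, E) p y w)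
      - differential E' σ y w * η (p y) (mfderiv 𝓘(ℝ, E') 𝓘(ℝ, E) p y v)
      + σ y * extDer η (p y) (mfderiv 𝓘(ℝ, E') 𝓘(ℝ, E) p y v)
        (mfderiv 𝓘(ℝ, E') 𝓘(ℝ, E) p y w) :=
  extDer_smul_pullback H.contact.smooth H.bundle.smooth H.factor.smooth
    (fun y v => (H.factor.smul_pullback y v).symm) y v w

theorem bijective_differential_prod (H : IsConformalSymplectization EQ Q n η θ p σ) (y : N) :
    Function.Bijective ((differential E' σ y).toLinearMap.prod
      (mfderiv 𝓘(ℝ, E') 𝓘(ℝ, E) p y).toLinearMap) :=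
  bijective_prod_of_nondegenerate (mfderiv 𝓘(ℝ, E') 𝓘(ℝ, E) p y).toLinearMap
    (H.bundle.mfderiv_surjective y) (differential E' σ y).toLinearMap (η (p y)).toLinearMap (σ y)
    (ContinuousLinearMap.coeLM ℝ ∘ₗ (extDer η (p y)).toLinearMap)
    (ContinuousLinearMap.coeLM ℝ ∘ₗ (extDer θ y).toLinearMap) (extDer_swap θ y) (H.extDer_eq y)
    (fun _ => H.symplectic.eq_zero_of_extDer)
    ⟨n, H.contact.finrank_tangentSpace (p y)⟩

theorem exists_tangent (H : IsConformalSymplectization EQ Q n η θ p σ) (y : N) (t : ℝ)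
    (u : TangentSpace 𝓘(ℝ, E) (p y)) : ∃ v : TangentSpace 𝓘(ℝ, E') y,
      differential E' σ y v = t ∧ mfderiv 𝓘(ℝ, E') 𝓘(ℝ, E) p y v = u := by
  obtain ⟨v, hv⟩ := (H.bijective_differential_prod y).2 (t, u)
  exact ⟨v, congrArg Prod.fst hv, congrArg Prod.snd hv⟩

theorem tangent_ext (H : IsConformalSymplectization EQ Q n η θ p σ) {y : N}
    {v w : TangentSpace 𝓘(ℝ, E') y} (h : differential E' σ y v = differential E' σ y w)
    (h' : mfderiv 𝓘(ℝ, E') 𝓘(ℝ, E) p y v = mfderiv 𝓘(ℝ, E') 𝓘(ℝ, E) p y w) : v = w :=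
  (H.bijective_differential_prod y).1 (Prod.ext h h')

theorem finrank_eq [Nonempty M] (H : IsConformalSymplectization EQ Q n η θ p σ) :
    Module.finrank ℝ E' = 2 * (n + 1) := by
  obtain ⟨y, -⟩ := H.bundle.surjective (Classical.arbitrary M)
  have h : Module.finrank ℝ E' = Module.finrank ℝ (ℝ × E) :=
    (LinearEquiv.ofBijective _ (H.bijective_differential_prod y)).finrank_eq
  rw [h, Module.finrank_prod, Module.finrank_self, H.contact.finrank_eq]
  ring

omit [FiniteDimensional ℝ E] [FiniteDimensional ℝ E'] in
theorem eq_of_extDer_eq (H : IsConformalSymplectization EQ Q n η θ p σ) {y : N}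
    {v w : TangentSpace 𝓘(ℝ, E') y} (h : ∀ u, extDer θ y v u = extDer θ y w u) : v = w :=
  sub_eq_zero.1 (H.symplectic.eq_zero_of_extDer fun u => by
    rw [map_sub, sub_apply, h, sub_self])

/-- The Liouville field is vertical and satisfies `dσ(Δ) = σ`. -/
theorem liouville_spec (H : IsConformalSymplectization EQ Q n η θ p σ) (y : N) :
    differential E' σ y (liouville θ y) = σ y ∧
      mfderiv 𝓘(ℝ, E') 𝓘(ℝ, E) p y (liouville θ y) = 0 := by
  obtain ⟨v, hv, hv'⟩ := H.exists_tangent y (σ y) 0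
  have h : liouville θ y = v := H.eq_of_extDer_eq fun u => by
    rw [H.symplectic.extDer_liouville, H.extDer_eq, hv, hv', ← H.factor.smul_pullback]
    simp
  exact h ▸ ⟨hv, hv'⟩

omit [FiniteDimensional ℝ E] [FiniteDimensional ℝ E'] in
theorem differential_symplectize (H : IsConformalSymplectization EQ Q n η θ p σ) {f : M → ℝ}
    (hf : f ∈ smoothFun E M) (y : N) (v : TangentSpace 𝓘(ℝ, E') y) :
    differential E' (symplectize p σ f) y v = -(differential E' σ y v * f (p y)
      + σ y * differential E f (p y) (mfderiv 𝓘(ℝ, E') 𝓘(ℝ, E) p y v)) := by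
  have hfd : MDifferentiableAt 𝓘(ℝ, E) 𝓘(ℝ, ℝ) f (p y) := (hf (p y)).mdifferentiableAt (by simp)
  have h : symplectize p σ f = fun z => -(σ z * f (p z)) := funext fun z => neg_mul _ _
  rw [h, differential_neg, ← differential_comp hfd (H.mdifferentiableAt_proj y)]
  exact congrArg Neg.neg (differential_mul (H.mdifferentiableAt_factor y)
    (hfd.comp y (H.mdifferentiableAt_proj y)) v)

theorem symplectize_mem_homogeneousFun (H : IsConformalSymplectization EQ Q n η θ p σ) {f : M → ℝ}
    (hf : f ∈ smoothFun E M) : symplectize p σ f ∈ homogeneousFun θ 1 := by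
  refine ⟨H.factor.smooth.neg.mul (ContMDiff.comp hf H.bundle.smooth), fun y => ?_⟩
  rw [H.differential_symplectize hf, (H.liouville_spec y).1, (H.liouville_spec y).2, map_zero,
    symplectize]
  simp

omit [FiniteDimensional ℝ E] [FiniteDimensional ℝ E'] in
theorem injective_symplectize (H : IsConformalSymplectization EQ Q n η θ p σ) :
    Function.Injective (symplectize p σ) := by
  intro f g hfg
  funext x
  obtain ⟨y, rfl⟩ := H.bundle.surjective x
  exact mul_left_cancel₀ (neg_ne_zero.2 (H.factor.ne_zero y)) (congrFun hfg y)

/-- The preimage of `g` is the function on the base induced by `-g / σ`. -/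
theorem surjOn_symplectize [IsManifold 𝓘(ℝ, EQ) ∞ Q]
    (H : IsConformalSymplectization EQ Q n η θ p σ) (hfib : ∀ x : M, IsConnected (p ⁻¹' {x})) :
    Set.SurjOn (symplectize p σ) (smoothFun E M) (homogeneousFun θ 1) := by
  rintro g ⟨hg, hg1⟩
  set h : N → ℝ := fun y => (-σ y)⁻¹ * g y with hdef
  have hgh : ∀ y, g y = -σ y * h y := fun y =>
    (mul_inv_cancel_left₀ (neg_ne_zero.2 (H.factor.ne_zero y)) _).symm
  have hh : ContMDiff 𝓘(ℝ, E') 𝓘(ℝ, ℝ) ∞ h :=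
    (H.factor.smooth.neg.inv₀ fun y => neg_ne_zero.2 (H.factor.ne_zero y)).mul hg
  have hvert : ∀ (y : N) (v : TangentSpace 𝓘(ℝ, E') y),
      mfderiv 𝓘(ℝ, E') 𝓘(ℝ, E) p y v = 0 → differential E' h y v = 0 := by
    intro y v hv
    have hσ := H.factor.ne_zero y
    -- Vertical vectors are determined by `dσ`, and `dσ(Δ) = σ ≠ 0`.
    have hv' : v = (differential E' σ y v / σ y) • liouville θ y := by
      apply H.tangent_ext
      · rw [map_smul, (H.liouville_spec y).1, smul_eq_mul, div_mul_cancel₀ _ hσ]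
      · rw [map_smul, (H.liouville_spec y).2, smul_zero, hv]
    have h1 : differential E' g y v = differential E' σ y v / σ y * g y := by
      conv_lhs => rw [hv']
      rw [map_smul, hg1, smul_eq_mul]
      simp
    have h2 : differential E' g y v =
        -(differential E' σ y v * h y + σ y * differential E' h y v) := by
      have : g = fun z => -(σ z * h z) := funext fun z => (hgh z).trans (neg_mul _ _)
      rw [this, differential_neg]
      exact congrArg Neg.neg (differential_mul (H.mdifferentiableAt_factor y)
        ((hh y).mdifferentiableAt (by simp)) v)
    rw [h1, hgh] at h2
    have h3 : σ y * differential E' h y v = 0 := by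
      field_simp at h2
      linarith
    exact (mul_eq_zero.1 h3).resolve_left hσ
  -- This section need not be continuous: `h` is constant on fibres, and smoothness of `h ∘ s` is
  -- checked after composing with `p`.
  choose s hs using H.bundle.surjective
  have hfp : ∀ y, h (s (p y)) = h y := fun y =>
    H.bundle.eq_of_differential_vertical_eq_zero hh hvert (hfib (p y)).isPreconnected (hs _) rfl
  refine ⟨fun x => h (s x), H.bundle.contMDiff_of_comp ?_, ?_⟩
  · simpa only [hfp] using hh
  · funext y
    rw [symplectize, hfp, hgh]

/-- `X_{f^Σ}` projects onto `X_f`, and `dσ(X_{f^Σ}) = σ R(f)`. -/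
theorem sympHam_symplectize_spec (H : IsConformalSymplectization EQ Q n η θ p σ) {f : M → ℝ}
    (hf : f ∈ smoothFun E M) (y : N) :
    differential E' σ y (sympHam θ (symplectize p σ f) y) =
        σ y * differential E f (p y) (reeb η (p y)) ∧
      mfderiv 𝓘(ℝ, E') 𝓘(ℝ, E) p y (sympHam θ (symplectize p σ f) y) = contactHam η f (p y) := by
  obtain ⟨v, hv, hv'⟩ := H.exists_tangent y (σ y * differential E f (p y) (reeb η (p y)))
    (contactHam η f (p y))
  have h : sympHam θ (symplectize p σ f) y = v := H.eq_of_extDer_eq fun u => by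
    rw [H.symplectic.extDer_sympHam, H.extDer_eq, hv, hv', H.contact.form_contactHam,
      H.contact.extDer_contactHam, H.differential_symplectize hf]
    ring
  exact h ▸ ⟨hv, hv'⟩

theorem eq_symplectize_of_mfderiv_sympHam (H : IsConformalSymplectization EQ Q n η θ p σ)
    {f : M → ℝ} {g : N → ℝ} (hg : IsHomogeneousFun θ 1 g)
    (h : ∀ y : N, mfderiv 𝓘(ℝ, E') 𝓘(ℝ, E) p y (sympHam θ g y) = contactHam η f (p y)) :
    g = symplectize p σ f := by
  funext y
  -- Evaluated at `Δ`, the Hamiltonian equation determines `dg(Δ) = g` from the projection of `X_g`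
  -- alone.
  have h1 := H.symplectic.extDer_sympHam g y (liouville θ y)
  rw [extDer_swap, H.symplectic.extDer_liouville, hg, ← H.factor.smul_pullback, h,
    H.contact.form_contactHam] at h1
  rw [symplectize]
  push_cast at h1
  linarith

theorem poissonBracket_symplectize (H : IsConformalSymplectization EQ Q n η θ p σ) {f g : M → ℝ}
    (hf : f ∈ smoothFun E M) (hg : g ∈ smoothFun E M) (y : N) :
    poissonBracket θ (symplectize p σ f) (symplectize p σ g) y =
      σ y * jacobiBracket η f g (p y) := by
  rw [poissonBracket_eq_neg_extDer, H.extDer_eq, (H.sympHam_symplectize_spec hf y).1,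
    (H.sympHam_symplectize_spec hf y).2, (H.sympHam_symplectize_spec hg y).1,
    (H.sympHam_symplectize_spec hg y).2, H.contact.form_contactHam, H.contact.form_contactHam,
    H.contact.jacobiBracket_eq]
  ring

omit [FiniteDimensional ℝ E] [IsManifold 𝓘(ℝ, E) ∞ M] in
theorem jacobiBracket_neg_neg (η : OneForm E M) (f g : M → ℝ) :
    jacobiBracket η (fun x => -f x) (fun x => -g x) = jacobiBracket η f g := by
  funext x
  simp [jacobiBracket, differential_neg]

/-- `σ p^*f` is the lift of `-f`, and the two signs cancel in the Jacobi bracket. -/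
theorem poissonBracket_factor_mul (H : IsConformalSymplectization EQ Q n η θ p σ) {f g : M → ℝ}
    (hf : f ∈ smoothFun E M) (hg : g ∈ smoothFun E M) :
    poissonBracket θ (fun y => σ y * f (p y)) (fun y => σ y * g (p y)) =
      fun y => σ y * jacobiBracket η f g (p y) := by
  have h : ∀ f : M → ℝ, (fun y => σ y * f (p y)) = symplectize p σ (fun x => -f x) := fun f =>
    funext fun y => (neg_mul_neg _ _).symm
  funext y
  rw [h f, h g, H.poissonBracket_symplectize (ContMDiff.neg hf) (ContMDiff.neg hg),
    jacobiBracket_neg_neg]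

/-- The lift of `F` has independent differentials at `y` if and only if the image of `T_{p y} F` and
`F (p y)` together span `ℝᵏ`. -/
theorem linearIndependent_differential_symplectizeMap_iff {k : ℕ}
    (H : IsConformalSymplectization EQ Q n η θ p σ) {F : M → Fin k → ℝ}
    (hF : ContMDiff 𝓘(ℝ, E) 𝓘(ℝ, Fin k → ℝ) ∞ F) (y : N) :
    LinearIndependent ℝ (fun i : Fin k => differential E' (fun z => symplectizeMap p σ F z i) y) ↔
      (LinearMap.range (mfderiv 𝓘(ℝ, E) 𝓘(ℝ, Fin k → ℝ) F (p y)).toLinearMap :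
        Submodule ℝ (Fin k → ℝ)) ⊔ Submodule.span ℝ {F (p y)} = ⊤ := by
  have hFi : ∀ i, (fun x => F x i) ∈ smoothFun E M := contMDiff_pi_space.1 hF
  have hFd : MDifferentiableAt 𝓘(ℝ, E) 𝓘(ℝ, Fin k → ℝ) F (p y) :=
    (hF (p y)).mdifferentiableAt (by simp)
  let dF : TangentSpace 𝓘(ℝ, E) (p y) →ₗ[ℝ] (Fin k → ℝ) :=
    (mfderiv 𝓘(ℝ, E) 𝓘(ℝ, Fin k → ℝ) F (p y)).toLinearMap
  have hlift : ∀ (c : Fin k → ℝ) (v : TangentSpace 𝓘(ℝ, E') y),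
      (∑ i, c i • differential E' (fun z => symplectizeMap p σ F z i) y) v =
        -(differential E' σ y v * (c ⬝ᵥ F (p y))
          + σ y * (c ⬝ᵥ dF (mfderiv 𝓘(ℝ, E') 𝓘(ℝ, E) p y v))) := by
    intro c v
    rw [sum_apply, dotProduct, dotProduct, Finset.mul_sum, Finset.mul_sum,
      ← Finset.sum_add_distrib, ← Finset.sum_neg_distrib]
    refine Finset.sum_congr rfl fun i _ => ?_
    have h : differential E' (fun z => symplectizeMap p σ F z i) y v =
      -(differential E' σ y v * F (p y) i
        + σ y * dF (mfderiv 𝓘(ℝ, E') 𝓘(ℝ, E) p y v) i) :=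
      (H.differential_symplectize (hFi i) y v).trans
        (by rw [differential_apply_coord hFd]; rfl)
    rw [smul_apply, h, smul_eq_mul]
    ring
  rw [Fintype.linearIndependent_iff, eq_top_iff_forall_dotProduct_eq_zero]
  refine forall_congr' fun c => ?_
  have hiff : ∑ i, c i • differential E' (fun z => symplectizeMap p σ F z i) y = 0 ↔
      ∀ s ∈ (LinearMap.range dF ⊔ Submodule.span ℝ {F (p y)}), c ⬝ᵥ s = 0 := by
    refine ⟨fun h => ?_, fun h => ContinuousLinearMap.ext fun v => ?_⟩
    · suffices hle : LinearMap.range dF ⊔ Submodule.span ℝ {F (p y)} ≤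
          LinearMap.ker (dotProductBilin ℝ ℝ c) from fun s hs => hle hs
      refine sup_le ?_ ((Submodule.span_singleton_le_iff_mem _ _).2 ?_)
      · rintro _ ⟨u, rfl⟩
        -- A lift of `u` with `dσ(v) = 0` isolates the `dF` term; below, a vertical vector with
        -- `dσ(v) = 1` isolates the `F` term.
        obtain ⟨v, hv, hv'⟩ := H.exists_tangent y 0 u
        have h1 := hlift c v
        rw [h, hv, hv', zero_apply, zero_mul, zero_add, zero_eq_neg] at h1
        exact (mul_eq_zero.1 h1).resolve_left (H.factor.ne_zero y)
      · obtain ⟨v, hv, hv'⟩ := H.exists_tangent y 1 0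
        have h1 := hlift c v
        rw [h, hv, hv', zero_apply, map_zero, dotProduct_zero, one_mul, mul_zero, add_zero,
          zero_eq_neg] at h1
        exact h1
    · rw [hlift, h _ (Submodule.mem_sup_right (Submodule.mem_span_singleton_self _)),
        h _ (Submodule.mem_sup_left (LinearMap.mem_range_self dF _))]
      simp
  exact imp_congr hiff funext_iff.symm

theorem isHomogeneousIntegrable_iff [Nonempty M] (H : IsConformalSymplectization EQ Q n η θ p σ)
    {F : M → Fin (n + 1) → ℝ} (hF : ContMDiff 𝓘(ℝ, E) 𝓘(ℝ, Fin (n + 1) → ℝ) ∞ F) :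
    IsHomogeneousIntegrable (n + 1) θ (symplectizeMap p σ F) ↔
      IsCompletelyIntegrableContact n η F ∧ IsTransverseToRays E F := by
  have hFi : ∀ i, (fun x => F x i) ∈ smoothFun E M := contMDiff_pi_space.1 hF
  have hbr : ∀ i j y, poissonBracket θ (fun z => symplectizeMap p σ F z i)
      (fun z => symplectizeMap p σ F z j) y =
        σ y * jacobiBracket η (fun x => F x i) (fun x => F x j) (p y) := fun i j y =>
    H.poissonBracket_symplectize (hFi i) (hFi j) y
  constructor
  · intro h
    have htr : IsTransverseToRays E F := fun x => by
      obtain ⟨y, rfl⟩ := H.bundle.surjective x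
      exact (H.linearIndependent_differential_symplectizeMap_iff hF y).1 (h.independent y)
    refine ⟨⟨H.contact, hF, fun i j x => ?_, fun x => ?_⟩, htr⟩
    · obtain ⟨y, rfl⟩ := H.bundle.surjective x
      exact (mul_eq_zero.1 ((hbr i j y).symm.trans (h.involution i j y))).resolve_left
        (H.factor.ne_zero y)
    · let dF : TangentSpace 𝓘(ℝ, E) x →ₗ[ℝ] (Fin (n + 1) → ℝ) :=
        (mfderiv 𝓘(ℝ, E) 𝓘(ℝ, Fin (n + 1) → ℝ) F x).toLinearMap
      -- The rank bound is implied by transversality: one vector adds at most one dimension to the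
      -- range, and together they span dimension `n + 1`.
      have h1 := Submodule.finrank_add_le_finrank_add_finrank (LinearMap.range dF)
        (Submodule.span ℝ {F x})
      have h2 : LinearMap.range dF ⊔ Submodule.span ℝ {F x} = ⊤ := htr x
      have h3 := finrank_span_le_card (R := ℝ) ({F x} : Set (Fin (n + 1) → ℝ))
      rw [h2, finrank_top, Module.finrank_fin_fun] at h1
      rw [Set.toFinset_singleton, Finset.card_singleton] at h3
      have h4 : n ≤ Module.finrank ℝ (LinearMap.range dF) := by omega
      exact h4
  · rintro ⟨h, htr⟩
    refine ⟨H.finrank_eq, H.symplectic, contMDiff_pi_space.2 fun i =>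
      (H.symplectize_mem_homogeneousFun (hFi i)).1, fun y => ?_, fun i j y => ?_, fun i =>
      (H.symplectize_mem_homogeneousFun (hFi i)).2⟩
    · exact (H.linearIndependent_differential_symplectizeMap_iff hF y).2 (htr (p y))
    · rw [hbr, h.involution, mul_zero]

end IsConformalSymplectization

end Symplectization
end ContactSymp

theorem theorem4p5
    {E : Type*} [NormedAddCommGroup E] [NormedSpace ℝ E] [FiniteDimensional ℝ E]
    {M : Type*} [TopologicalSpace M] [T2Space M] [SecondCountableTopology M] [Nonempty M]
    [ChartedSpace E M] [IsManifold 𝓘(ℝ, E) ∞ M]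
    {E' : Type*} [NormedAddCommGroup E'] [NormedSpace ℝ E'] [FiniteDimensional ℝ E']
    {N : Type*} [TopologicalSpace N] [T2Space N] [SecondCountableTopology N]
    [ChartedSpace E' N] [IsManifold 𝓘(ℝ, E') ∞ N]
    {EQ : Type*} [NormedAddCommGroup EQ] [NormedSpace ℝ EQ] [FiniteDimensional ℝ EQ]
    {Q : Type*} [TopologicalSpace Q] [ChartedSpace EQ Q] [IsManifold 𝓘(ℝ, EQ) ∞ Q]
    (n : ℕ) (η : OneForm E M) (hη : IsContactForm n η)
    (θ : OneForm E' N) (hθ : IsExactSymplectic θ)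
    (p : N → M) (hp : IsSymplectization EQ Q η θ p)
    (σ : N → ℝ) (hσ : IsConformalFactor η θ p σ) :
    -- `f ↦ f^Σ` is injective from smooth functions to smooth homogeneous functions of degree one
    (Set.MapsTo (symplectize p σ) (smoothFun E M) (homogeneousFun θ 1) ∧
      Set.InjOn (symplectize p σ) (smoothFun E M)) ∧
    -- and it is bijective if the fibres are connected
    ((∀ x : M, IsConnected (p ⁻¹' {x})) →
      Set.BijOn (symplectize p σ) (smoothFun E M) (homogeneousFun θ 1)) ∧
    -- `f^Σ` is the homogeneous function of degree one whose Hamiltonian vector field projects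
    -- onto that of `f`
    (∀ f ∈ smoothFun E M, ∀ y : N,
      mfderiv 𝓘(ℝ, E') 𝓘(ℝ, E) p y (sympHam θ (symplectize p σ f) y) = contactHam η f (p y)) ∧
    (∀ f ∈ smoothFun E M, ∀ g ∈ homogeneousFun θ 1,
      (∀ y : N, mfderiv 𝓘(ℝ, E') 𝓘(ℝ, E) p y (sympHam θ g y) = contactHam η f (p y)) →
        g = symplectize p σ f) ∧
    -- brackets
    (∀ f ∈ smoothFun E M, ∀ g ∈ smoothFun E M,
      poissonBracket θ (symplectize p σ f) (symplectize p σ g) =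
        -symplectize p σ (jacobiBracket η f g) ∧
      poissonBracket θ (fun y => σ y * f (p y)) (fun y => σ y * g (p y)) =
        fun y => σ y * jacobiBracket η f g (p y)) ∧
    -- integrable systems
    (∀ F : M → Fin (n + 1) → ℝ, ContMDiff 𝓘(ℝ, E) 𝓘(ℝ, Fin (n + 1) → ℝ) ∞ F →
      (IsHomogeneousIntegrable (n + 1) θ (symplectizeMap p σ F) ↔
        IsCompletelyIntegrableContact n η F ∧ IsTransverseToRays E F)) := by
  have H : IsConformalSymplectization EQ Q n η θ p σ := ⟨hη, hθ, hp.bundle, hσ⟩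
  have hmaps : Set.MapsTo (symplectize p σ) (smoothFun E M) (homogeneousFun θ 1) :=
    fun _ hf => H.symplectize_mem_homogeneousFun hf
  have hinj : Set.InjOn (symplectize p σ) (smoothFun E M) := H.injective_symplectize.injOn
  refine ⟨⟨hmaps, hinj⟩, fun hfib => ⟨hmaps, hinj, H.surjOn_symplectize hfib⟩,
    fun f hf y => (H.sympHam_symplectize_spec hf y).2,
    fun f _ g hg h => H.eq_symplectize_of_mfderiv_sympHam hg.2 h,
    fun f hf g hg => ⟨funext fun y => ?_, H.poissonBracket_factor_mul hf hg⟩,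
    fun F hF => H.isHomogeneousIntegrable_iff hF⟩
  rw [H.poissonBracket_symplectize hf hg, Pi.neg_apply, symplectize, neg_mul, neg_neg]
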